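/- Let $N\ge 1$, let $\Omega\subset\mathbb R^N$ be a domain, $T>0$, $\Omega_T=\Omega\times(0,T)$. Let $m>0$, $p>1$, $K_1,K_2>0$, put $m^-=\min(1,m)$ and $\lambda=m(p-1)$, and assume $\lambda>1$ and $p<2$ (so $m>1$ and $m^-=1$). Let $\mathbf A:\Omega_T\times\mathbb R_+\times\mathbb R^N\to\mathbb R^N$ be a Carathéodory function (measurable in $(x,t)$ for all $(u,\xi)$, continuous in $(u,\xi)$ for almost every $(x,t)$) satisfying the structure conditions $$\mathbf A(x,t,u,Du)\cdot Du^{m^-}\ge K_1u^{(m-m^-)(p-1)}|Du^{m^-}|^p,\qquad |\mathbf A(x,t,u,Du)|\le K_2u^{(m-m^-)(p-1)}|Du^{m^-}|^{p-1}.$$ A nonnegative, locally bounded, local weak solution of $u_t-\operatorname{div}\mathbf A(x,t,u,Du)=0$ in $\Omega_T$ is a function $0\le u\in C_{\rm loc}(0,T;L^{1+m^-}_{\rm loc}(\Omega))\cap L^\infty_{\rm loc}(\Omega_T)$ with $u^{m^-}\in L^p_{\rm loc}(0,T;W^{1,p}_{\rm loc}(\Omega))$ such that, for every compact $E\subset\Omega$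 and all $0<t_1\le t_2<T$, $$\int_E u\zeta\,dx\Big|_{t_1}^{t_2}+\int_{t_1}^{t_2}\!\!\int_E\{-u\zeta_\tau+\mathbf A(x,\tau,u,Du)\cdot D\zeta\}\,dx\,d\tau=0$$ for all $0\le\zeta\in W^{1,1+1/m^-}(0,T;L^{1+1/m^-}(E))\cap L^p(0,T;W^{1,p}_0(E))$. Theorem. There is a constant $\gamma>0$ depending only on $N,m,p,K_1,K_2$ such that the following holds for every such $\Omega$, $T$, $\mathbf A$ and every such solution $u$. Let $y\in\mathbb R^N$, $r>0$, $s<t$ be such that $Q_{2r,t-s}(y,t):=B_{2r}(y)\times(s,t)\subset\Omega_T$, and let $\mu^+\in\mathbb R$ satisfy $u\le\mu^+$ almost everywhere in $Q_{2r,t-s}(y,t)$. Then $\mu^+-u(\cdot,\tau)$ is integrable on $B_{2r}(y)$ for every $\tau\in[s,t]\cap(0,T)$, and $$\sup_{\tau}\frac1{|B_r|}\int_{B_r(y)}(\mu^+-u(x,\tau))\,dx\le\gamma\inf_{\tau}\frac1{|B_{2r}|}\int_{B_{2r}(y)}(\mu^+-u(x,\tau))\,dx+\gamma\,[\mu^+]^{\frac{(m-1)(p-1)}{2-p}}\Big(\frac{t-s}{r^p}\Big)^{\frac1{2-p}},$$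 where the supremum and the infimum are taken over all $\tau\in[s,t]\cap(0,T)$. -/

import Mathlib

open MeasureTheory Set Filter Topology
open scoped ContDiff

namespace DoublyNonlinear

/-- `N`-dimensional Euclidean space. -/
abbrev Space (N : ℕ) : Type := EuclideanSpace ℝ (Fin N)

/-- The exponent `m⁻ = min (1, m)`. -/
noncomputable def mMinus (m : ℝ) : ℝ := min 1 m

/-- The space-time cylinder `Ω_T = Ω × (0, T)`. -/
def spaceTime {N : ℕ} (Ω : Set (Space N)) (T : ℝ) : Set (Space N × ℝ) := Ω ×ˢ Ioo 0 T

/-- `g` is the weak gradient of `f` in the open set `Ω`. -/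
def HasWeakGradient {N : ℕ} (Ω : Set (Space N)) (f : Space N → ℝ) (g : Space N → Space N) : Prop :=
  LocallyIntegrableOn f Ω ∧ LocallyIntegrableOn g Ω ∧
    ∀ φ : Space N → ℝ, ContDiff ℝ ∞ φ → HasCompactSupport φ → tsupport φ ⊆ Ω →
      ∫ x in Ω, f x • gradient φ x = - ∫ x in Ω, φ x • g x

/-- `f ∈ W₀^{1,p}(E)` with gradient `g`: the pair `(f, g)` is the limit in `L^p(E)` of pairs
`(φ_k, ∇ φ_k)` with `φ_k` smooth and compactly supported in the interior of `E`. -/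
def MemW01p {N : ℕ} (p : ℝ) (E : Set (Space N)) (f : Space N → ℝ) (g : Space N → Space N) : Prop :=
  MemLp f (ENNReal.ofReal p) (volume.restrict E) ∧
  MemLp g (ENNReal.ofReal p) (volume.restrict E) ∧
  ∃ φ : ℕ → Space N → ℝ,
    (∀ k, ContDiff ℝ ∞ (φ k) ∧ HasCompactSupport (φ k) ∧ tsupport (φ k) ⊆ interior E) ∧
    Tendsto (fun k => eLpNorm (fun x => f x - φ k x) (ENNReal.ofReal p) (volume.restrict E))
      atTop (𝓝 0) ∧
    Tendsto (fun k => eLpNorm (fun x => g x - gradient (φ k) x) (ENNReal.ofReal p)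
      (volume.restrict E)) atTop (𝓝 0)

/-- Nonnegative testing functions
`ζ ∈ W^{1,q}(0,T; L^q(E)) ∩ L^p(0,T; W₀^{1,p}(E))`, `q = 1 + 1/m⁻`, given together with their weak
time derivative `ζt` and their weak spatial gradient `ζx`.  As usual `ζ` is the representative that
is (absolutely) continuous from `[0,T]` to `L^q(E)`, so that it has values at every time. -/
structure IsTestFunction {N : ℕ} (m p T : ℝ) (E : Set (Space N))
    (ζ ζt : Space N → ℝ → ℝ) (ζx : Space N → ℝ → Space N) : Prop where
  memLp : MemLp (fun z : Space N × ℝ => ζ z.1 z.2) (ENNReal.ofReal (1 + 1 / mMinus m))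
    (volume.restrict (E ×ˢ Ioo 0 T))
  memLp_time : MemLp (fun z : Space N × ℝ => ζt z.1 z.2) (ENNReal.ofReal (1 + 1 / mMinus m))
    (volume.restrict (E ×ˢ Ioo 0 T))
  time_deriv : ∀ t₁ ∈ Icc 0 T, ∀ t₂ ∈ Icc 0 T, t₁ ≤ t₂ →
    ∀ᵐ x ∂(volume.restrict E), ζ x t₂ - ζ x t₁ = ∫ τ in t₁..t₂, ζt x τ
  memLp_space : MemLp (fun z : Space N × ℝ => ζ z.1 z.2) (ENNReal.ofReal p)
    (volume.restrict (E ×ˢ Ioo 0 T))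
  memLp_grad : MemLp (fun z : Space N × ℝ => ζx z.1 z.2) (ENNReal.ofReal p)
    (volume.restrict (E ×ˢ Ioo 0 T))
  slice : ∀ᵐ t ∂(volume.restrict (Ioo 0 T)), MemW01p p E (fun x => ζ x t) (fun x => ζx x t)
  nonneg : ∀ t ∈ Icc 0 T, ∀ᵐ x ∂(volume.restrict E), 0 ≤ ζ x t

/-- `A : Ω_T × ℝ₊ × ℝ^N → ℝ^N` is a Carathéodory function. -/
structure IsCaratheodory {N : ℕ} (Ω : Set (Space N)) (T : ℝ)
    (A : Space N → ℝ → ℝ → Space N → Space N) : Prop where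
  measurable : ∀ v : ℝ, 0 ≤ v → ∀ ξ : Space N,
    AEStronglyMeasurable (fun z : Space N × ℝ => A z.1 z.2 v ξ) (volume.restrict (spaceTime Ω T))
  continuous : ∀ᵐ z ∂(volume.restrict (spaceTime Ω T)),
    ContinuousOn (fun w : ℝ × Space N => A z.1 z.2 w.1 w.2) (Ici 0 ×ˢ univ)

/-- `D (v^{m⁻}) = m⁻ v^{m⁻ - 1} D v`, as a function of the value `v > 0` and of `ξ = D v`. -/
noncomputable def gradPow {N : ℕ} (m v : ℝ) (ξ : Space N) : Space N :=
  (mMinus m * v ^ (mMinus m - 1)) • ξ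

/-- The structure conditions (growth and coercivity) with constants `K₁`, `K₂`.  They are imposed at
positive values `v` only, where `gradPow` is meaningful; for `m ≥ 1` they extend to `v = 0` by
continuity of `A`. -/
structure StructureConditions {N : ℕ} (Ω : Set (Space N)) (T m p K₁ K₂ : ℝ)
    (A : Space N → ℝ → ℝ → Space N → Space N) : Prop where
  coercive : ∀ᵐ z ∂(volume.restrict (spaceTime Ω T)), ∀ v : ℝ, 0 < v → ∀ ξ : Space N,
    K₁ * v ^ ((m - mMinus m) * (p - 1)) * ‖gradPow m v ξ‖ ^ p
      ≤ inner ℝ (A z.1 z.2 v ξ) (gradPow m v ξ)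
  growth : ∀ᵐ z ∂(volume.restrict (spaceTime Ω T)), ∀ v : ℝ, 0 < v → ∀ ξ : Space N,
    ‖A z.1 z.2 v ξ‖ ≤ K₂ * v ^ ((m - mMinus m) * (p - 1)) * ‖gradPow m v ξ‖ ^ (p - 1)

/-- The regularity class of nonnegative, locally bounded, local weak solutions:
`0 ≤ u ∈ C_loc(0,T; L^{1+m⁻}_loc(Ω)) ∩ L^∞_loc(Ω_T)` and
`u^{m⁻} ∈ L^p_loc(0,T; W^{1,p}_loc(Ω))`, where `V = D (u^{m⁻})` is the weak spatial gradient. -/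
structure IsRegular {N : ℕ} (Ω : Set (Space N)) (T m p : ℝ)
    (u : Space N → ℝ → ℝ) (V : Space N → ℝ → Space N) : Prop where
  measurable : AEStronglyMeasurable (fun z : Space N × ℝ => u z.1 z.2)
    (volume.restrict (spaceTime Ω T))
  nonneg : ∀ᵐ z ∂(volume.restrict (spaceTime Ω T)), 0 ≤ u z.1 z.2
  memLp_slice : ∀ K : Set (Space N), IsCompact K → K ⊆ Ω → ∀ t ∈ Ioo 0 T,
    MemLp (fun x => u x t) (ENNReal.ofReal (1 + mMinus m)) (volume.restrict K)
  continuous : ∀ K : Set (Space N), IsCompact K → K ⊆ Ω → ∀ t ∈ Ioo 0 T,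
    Tendsto (fun s => eLpNorm (fun x => u x s - u x t) (ENNReal.ofReal (1 + mMinus m))
      (volume.restrict K)) (𝓝 t) (𝓝 0)
  locallyBounded : ∀ K : Set (Space N × ℝ), IsCompact K → K ⊆ spaceTime Ω T →
    MemLp (fun z : Space N × ℝ => u z.1 z.2) ⊤ (volume.restrict K)
  memLp_pow : ∀ K : Set (Space N), IsCompact K → K ⊆ Ω → ∀ a b : ℝ, 0 < a → b < T →
    MemLp (fun z : Space N × ℝ => u z.1 z.2 ^ mMinus m) (ENNReal.ofReal p)
      (volume.restrict (K ×ˢ Icc a b))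
  memLp_grad : ∀ K : Set (Space N), IsCompact K → K ⊆ Ω → ∀ a b : ℝ, 0 < a → b < T →
    MemLp (fun z : Space N × ℝ => V z.1 z.2) (ENNReal.ofReal p) (volume.restrict (K ×ˢ Icc a b))
  weakGradient : ∀ᵐ t ∂(volume.restrict (Ioo 0 T)),
    HasWeakGradient Ω (fun x => u x t ^ mMinus m) (fun x => V x t)

/-- The gradient `D u = (1/m⁻) u^{1 - m⁻} D (u^{m⁻})`, expressed through `V = D (u^{m⁻})`.
If `m ≥ 1` this is `V` itself. -/
noncomputable def spatialGradient {N : ℕ} (m : ℝ) (u : Space N → ℝ → ℝ)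
    (V : Space N → ℝ → Space N) (x : Space N) (t : ℝ) : Space N :=
  ((1 / mMinus m) * u x t ^ (1 - mMinus m)) • V x t

/-- The left-hand side of the weak formulation,
`∫_E u ζ dx |_{t₁}^{t₂} + ∫_{t₁}^{t₂} ∫_E { - u ζ_τ + A(x, τ, u, D u) · D ζ } dx dτ`,
where `Du` stands for `D u`. -/
noncomputable def weakForm {N : ℕ} (A : Space N → ℝ → ℝ → Space N → Space N)
    (E : Set (Space N)) (t₁ t₂ : ℝ) (u : Space N → ℝ → ℝ) (Du : Space N → ℝ → Space N)
    (ζ ζt : Space N → ℝ → ℝ) (ζx : Space N → ℝ → Space N) : ℝ :=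
  ((∫ x in E, u x t₂ * ζ x t₂) - ∫ x in E, u x t₁ * ζ x t₁) +
    ∫ τ in t₁..t₂, ∫ x in E,
      (- (u x τ * ζt x τ) + inner ℝ (A x τ (u x τ) (Du x τ)) (ζx x τ))

/-- `u` is a nonnegative, locally bounded, local weak solution of `u_t - div A(x, t, u, D u) = 0`
in `Ω_T`, that is, both a subsolution (`weakForm ≤ 0`) and a supersolution (`weakForm ≥ 0`). -/
def IsWeakSolution {N : ℕ} (Ω : Set (Space N)) (T m p : ℝ)
    (A : Space N → ℝ → ℝ → Space N → Space N) (u : Space N → ℝ → ℝ) : Prop :=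
  ∃ V : Space N → ℝ → Space N, IsRegular Ω T m p u V ∧
    ∀ E : Set (Space N), IsCompact E → E ⊆ Ω → ∀ t₁ t₂ : ℝ, 0 < t₁ → t₁ ≤ t₂ → t₂ < T →
      ∀ ζ ζt ζx, IsTestFunction m p T E ζ ζt ζx →
        weakForm A E t₁ t₂ u (spatialGradient m u V) ζ ζt ζx ≤ 0 ∧
        0 ≤ weakForm A E t₁ t₂ u (spatialGradient m u V) ζ ζt ζx

end DoublyNonlinear

namespace DoublyNonlinear

/-! From `m(p-1) > 1` and `p < 2` one gets `m > 1`, so `V` is the gradient of `u` itself. With `e =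
(m-1)(p-1)` the equation is then a singular p-Laplacian with weight `u^e ≤ μ^e`, which appears in
both the growth and the coercivity bound.

Let `ζ` be a cutoff with `|∇ζ| ≤ L`, and let `f(τ) = ∫ ζ^(k+2) (μ - u)`. Testing with `ζ^(k+2)`
shows that `f` varies in time only through the flux against `∇ζ`. To control this flux put `W = μ +
ν - u`, `α = (2-p)/p`, `β = 1 - α`, and test with `ζ^(k+2) W^(-α)`. If `L^p μ^e (t-s) ≤ Λ ν^(2-p)`,
Young's inequality bounds `∬ ζ^(k+2) W^(-α-1) A·Du` by a multiple of `G = sup ∫ ζ^k W^β`, and a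
second application gives `|f(τ) - f(τ')| ≤ C ν^α G` (`exists_abs_integral_sub_le`). Since `β < 1`,
one has `ν^α W^β ≤ δ W + C_δ ν`, so the oscillation of `f` is at most `(sup f)/2 + C ν |B|`
(`exists_abs_weighted_integral_sub_le`). As `sup f` is finite it can be absorbed: `sup f ≤ 2 f(τ₂) +
2 C ν |B|`. The smallest `ν` allowed by the smallness condition, up to constants, is the last term
of the inequality.

The nonlinear test functions are justified by `IsDivergenceSolution.energy_identity`. The weak
formulation is used only with smooth functions of `x`: tested with translates of a mollifier, it
says that the spatial mollification of `u` is, at each fixed `x`, a primitive in time. The chain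
rule in time, integration by parts in space and removal of the mollifier give the identity. -/

/-! ### The chain rule along absolutely continuous functions. -/

theorem _root_.LipschitzOnWith.comp_absolutelyContinuousOnInterval {f g : ℝ → ℝ} {K : NNReal} {s : Set ℝ}
    {a b : ℝ} (hf : LipschitzOnWith K f s) (hg : AbsolutelyContinuousOnInterval g a b)
    (hgs : MapsTo g (uIcc a b) s) : AbsolutelyContinuousOnInterval (f ∘ g) a b := by
  rw [absolutelyContinuousOnInterval_iff] at hg ⊢
  intro ε hε
  obtain ⟨δ, hδ, h⟩ := hg (ε / (K + 1)) (by positivity)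
  refine ⟨δ, hδ, fun E hE hEδ ↦ ?_⟩
  have h1 := h E hE hEδ
  have h2 : ∑ i ∈ Finset.range E.1, dist ((f ∘ g) (E.2 i).1) ((f ∘ g) (E.2 i).2) ≤
      K * ∑ i ∈ Finset.range E.1, dist (g (E.2 i).1) (g (E.2 i).2) := by
    rw [Finset.mul_sum]
    refine Finset.sum_le_sum fun i hi ↦ ?_
    exact hf.dist_le_mul _ (hgs (hE.1 i hi).1) _ (hgs (hE.1 i hi).2)
  have h3 : 0 ≤ ∑ i ∈ Finset.range E.1, dist (g (E.2 i).1) (g (E.2 i).2) :=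
    Finset.sum_nonneg fun _ _ ↦ dist_nonneg
  rw [lt_div_iff₀ (by positivity)] at h1
  nlinarith

/-- As `b` is merely integrable, `h` is differentiable only almost everywhere. But `Φ` is Lipschitz
on `[c, d]`, so `Φ ∘ h` is absolutely continuous and the fundamental theorem of calculus applies to
it. -/
theorem integral_comp_mul_of_primitive {Φ g h b : ℝ → ℝ} {c d t₁ t₂ : ℝ} (h12 : t₁ ≤ t₂)
    (hΦ : ∀ v ∈ Icc c d, HasDerivAt Φ (g v) v) (hg : ContinuousOn g (Icc c d))
    (hh : ∀ t ∈ Icc t₁ t₂, h t ∈ Icc c d) (hb : IntervalIntegrable b volume t₁ t₂)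
    (hprim : ∀ t ∈ Icc t₁ t₂, h t - h t₁ = ∫ τ in t₁..t, b τ) :
    Φ (h t₂) - Φ (h t₁) = ∫ τ in t₁..t₂, g (h τ) * b τ := by
  obtain ⟨C, hC⟩ := isCompact_Icc.exists_bound_of_continuousOn hg
  have hC' : ∀ v ∈ Icc c d, ‖g v‖₊ ≤ C.toNNReal := fun v hv ↦ by
    rw [← NNReal.coe_le_coe]; exact (hC v hv).trans (Real.le_coe_toNNReal C)
  have hL : LipschitzOnWith C.toNNReal Φ (Icc c d) :=
    (convex_Icc c d).lipschitzOnWith_of_nnnorm_hasDerivWithin_le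
      (fun v hv ↦ (hΦ v hv).hasDerivWithinAt) hC'
  have hac0 := hb.absolutelyContinuousOnInterval_intervalIntegral (c := t₁) left_mem_uIcc
  have hmaps : MapsTo (fun t ↦ h t₁ + ∫ τ in t₁..t, b τ) (uIcc t₁ t₂) (Icc c d) := by
    intro t ht
    rw [uIcc_of_le h12] at ht
    beta_reduce
    rw [show h t₁ + ∫ τ in t₁..t, b τ = h t by rw [← hprim t ht]; ring]
    exact hh t ht
  have hac1 : AbsolutelyContinuousOnInterval (fun t ↦ h t₁ + ∫ τ in t₁..t, b τ) t₁ t₂ := by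
    rw [absolutelyContinuousOnInterval_iff] at hac0 ⊢
    simpa using hac0
  have hac := hL.comp_absolutelyContinuousOnInterval hac1 hmaps
  have e := hac.integral_deriv_eq_sub
  have heq : ∀ t ∈ Icc t₁ t₂, h t₁ + ∫ τ in t₁..t, b τ = h t := fun t ht ↦ by
    rw [← hprim t ht]; ring
  simp only [Function.comp] at e
  rw [heq t₂ (right_mem_Icc.2 h12), heq t₁ (left_mem_Icc.2 h12)] at e
  rw [← e]
  apply intervalIntegral.integral_congr_ae
  filter_upwards [hb.ae_hasDerivAt_integral] with x hx hx'
  have hxI : x ∈ uIcc t₁ t₂ := uIoc_subset_uIcc hx'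
  have h1 := (hx hxI t₁ left_mem_uIcc).const_add (h t₁)
  rw [uIcc_of_le h12] at hxI
  have h2 : HasDerivAt Φ (g (h t₁ + ∫ τ in t₁..x, b τ)) (h t₁ + ∫ τ in t₁..x, b τ) := by
    rw [heq x hxI]; exact hΦ _ (hh x hxI)
  have h3 := (h2.comp x h1).deriv
  rw [heq x hxI] at h3
  exact h3

/-! ### Spatial mollification in space-time Lebesgue spaces. -/

variable {E F : Type*}

/-- A spatial shift preserves the product measure, and composition with measure preserving maps is
continuous on `L^q` for finite `q`. -/
theorem tendsto_eLpNorm_comp_sub_fst [NormedAddCommGroup E] [NormedSpace ℝ E]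
    [FiniteDimensional ℝ E] [MeasurableSpace E] [BorelSpace E] [NormedAddCommGroup F]
    {κ : Measure E} [κ.IsAddHaarMeasure] {ν : Measure ℝ} [IsFiniteMeasure ν]
    {q : ENNReal} (hq1 : 1 ≤ q) (hq : q ≠ ⊤) {f : E × ℝ → F} (hf : MemLp f q (κ.prod ν)) :
    Tendsto (fun y : E ↦ eLpNorm (fun z : E × ℝ ↦ f (z.1 - y, z.2) - f z) q (κ.prod ν))
      (𝓝 0) (𝓝 0) := by
  have : Fact (1 ≤ q) := ⟨hq1⟩
  let T : E → C(E × ℝ, E × ℝ) := fun y ↦ ⟨fun z ↦ (z.1 - y, z.2), by fun_prop⟩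
  have hT : ∀ y, MeasurePreserving (T y) (κ.prod ν) (κ.prod ν) := fun y ↦
    (measurePreserving_sub_right κ y).prod (MeasurePreserving.id ν)
  have hTc : Continuous T := by
    apply ContinuousMap.continuous_of_continuous_uncurry
    simp only [T, Function.uncurry_def, ContinuousMap.coe_mk]
    fun_prop
  have h := Filter.Tendsto.compMeasurePreservingLp (l := 𝓝 (0 : E))
    (f := fun _ ↦ hf.toLp f) tendsto_const_nhds (hTc.tendsto 0) hT (hT 0) hq
  rw [tendsto_iff_edist_tendsto_0] at h
  refine h.congr fun y ↦ ?_
  rw [Lp.edist_def]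
  refine eLpNorm_congr_ae ?_
  have e1 := Lp.coeFn_compMeasurePreserving (hf.toLp f) (hT y)
  have e2 := Lp.coeFn_compMeasurePreserving (hf.toLp f) (hT 0)
  have e3 := (hT y).quasiMeasurePreserving.ae_eq_comp hf.coeFn_toLp
  have e4 := (hT 0).quasiMeasurePreserving.ae_eq_comp hf.coeFn_toLp
  filter_upwards [e1, e2, e3, e4] with z h1 h2 h3 h4
  rw [Pi.sub_apply, h1, h2, h3, h4]
  simp [T]

theorem enorm_integral_sub_le_eLpNorm {α F : Type*} [MeasurableSpace α] [NormedAddCommGroup F]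
    [NormedSpace ℝ F] [CompleteSpace F] {P : Measure α} [IsProbabilityMeasure P] {h : α → F}
    (hh : AEStronglyMeasurable h P) (c : F) {q : ENNReal} (hq : 1 ≤ q) :
    ‖(∫ y, h y ∂P) - c‖ₑ ≤ eLpNorm (fun y ↦ h y - c) q P := by
  have hm : AEStronglyMeasurable (fun y ↦ h y - c) P := hh.sub aestronglyMeasurable_const
  refine le_trans ?_ (eLpNorm_le_eLpNorm_of_exponent_le hq hm)
  by_cases hi : Integrable h P
  · have : (∫ y, h y ∂P) - c = ∫ y, (h y - c) ∂P := by
      rw [integral_sub hi (integrable_const c)]; simp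
    rw [this, eLpNorm_one_eq_lintegral_enorm]
    exact enorm_integral_le_lintegral_enorm _
  -- A non-integrable `h` has integral zero by convention, but then the right-hand side is infinite.
  · have : eLpNorm (fun y ↦ h y - c) 1 P = ⊤ := by
      by_contra hne
      have h1 : MemLp (fun y ↦ h y - c) 1 P := ⟨hm, lt_top_iff_ne_top.2 hne⟩
      apply hi
      refine ((memLp_one_iff_integrable.1 h1).add (integrable_const c)).congr (ae_of_all _ fun y ↦ ?_)
      simp
    rw [this]; exact le_top

/-- The convolution of `f` with the kernel `ρ`. -/
noncomputable def mollify {N : ℕ} {F : Type*} [NormedAddCommGroup F] [NormedSpace ℝ F]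
    (ρ : Space N → ℝ) (f : Space N → F) (x : Space N) : F :=
  ∫ z, ρ (x - z) • f z

section

variable {N : ℕ} {F : Type*} [NormedAddCommGroup F] [NormedSpace ℝ F] {ρ : Space N → ℝ}

theorem mollify_eq (ρ : Space N → ℝ) (f : Space N → F) (x : Space N) :
    mollify ρ f x = ∫ y, ρ y • f (x - y) := by
  rw [mollify, ← integral_sub_left_eq_self _ volume x]
  simp

theorem isProbabilityMeasure_withDensity_ofReal (h0 : ∀ x, 0 ≤ ρ x) (h1 : ∫ x, ρ x = 1) :
    IsProbabilityMeasure (volume.withDensity fun x ↦ ENNReal.ofReal (ρ x)) := by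
  have hint : Integrable ρ := by
    by_contra hi
    rw [integral_undef hi] at h1
    exact zero_ne_one h1
  constructor
  rw [withDensity_apply _ MeasurableSet.univ, Measure.restrict_univ,
    ← ofReal_integral_eq_lintegral_ofReal hint (ae_of_all _ h0), h1, ENNReal.ofReal_one]

theorem mollify_eq_integral_withDensity (hc : Continuous ρ) (h0 : ∀ x, 0 ≤ ρ x)
    (f : Space N → F) (x : Space N) :
    mollify ρ f x = ∫ y, f (x - y) ∂(volume.withDensity fun x ↦ ENNReal.ofReal (ρ x)) := by
  rw [mollify_eq, integral_withDensity_eq_integral_toReal_smul (by fun_prop) (by simp)]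
  simp [ENNReal.toReal_ofReal (h0 _)]

theorem quasiMeasurePreserving_sub_fst {ν : Measure ℝ} [SFinite ν] {P : Measure (Space N)}
    [SFinite P] : Measure.QuasiMeasurePreserving
      (fun w : (Space N × ℝ) × Space N ↦ (w.1.1 - w.2, w.1.2))
      (((volume : Measure (Space N)).prod ν).prod P) ((volume : Measure (Space N)).prod ν) :=
  QuasiMeasurePreserving.prod_of_left (by fun_prop) (ae_of_all _ fun y ↦
    ((measurePreserving_sub_right volume y).prod (MeasurePreserving.id ν)).quasiMeasurePreserving)

/-- Mollifying averages translates over the probability measure `ρ dx`. By Jensen and Fubini the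
`q`-th power of the error is at most the average of the `q`-th powers of the translation errors, and
only shifts with `ρ y ≠ 0` count. -/
theorem eLpNorm_mollify_sub_le [CompleteSpace F] {ν : Measure ℝ} [IsFiniteMeasure ν]
    {q : ℝ} (hq : 1 ≤ q)
    {f : Space N × ℝ → F} (hf : AEStronglyMeasurable f ((volume : Measure (Space N)).prod ν))
    (hc : Continuous ρ) (h0 : ∀ x, 0 ≤ ρ x) (h1 : ∫ x, ρ x = 1) {ε : ENNReal}
    (hε : ∀ y, ρ y ≠ 0 → eLpNorm (fun z : Space N × ℝ ↦ f (z.1 - y, z.2) - f z)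
      (ENNReal.ofReal q) ((volume : Measure (Space N)).prod ν) ≤ ε) :
    eLpNorm (fun z : Space N × ℝ ↦ mollify ρ (fun x ↦ f (x, z.2)) z.1 - f z) (ENNReal.ofReal q)
      ((volume : Measure (Space N)).prod ν) ≤ ε := by
  have := isProbabilityMeasure_withDensity_ofReal h0 h1
  set P : Measure (Space N) := volume.withDensity fun x ↦ ENNReal.ofReal (ρ x) with hP
  have hq0 : 0 < q := by linarith
  have hqr : (ENNReal.ofReal q).toReal = q := ENNReal.toReal_ofReal hq0.le
  have hqne : ENNReal.ofReal q ≠ 0 := by simpa using hq0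
  have key : ∀ {β : Type} [MeasurableSpace β] (κ : Measure β) (g : β → F),
      eLpNorm g (ENNReal.ofReal q) κ = (∫⁻ z, ‖g z‖ₑ ^ q ∂κ) ^ (1 / q) := fun κ g ↦ by
    rw [eLpNorm_eq_lintegral_rpow_enorm_toReal hqne ENNReal.ofReal_ne_top, hqr]
  have key2 : ∀ {β : Type} [MeasurableSpace β] (κ : Measure β) (g : β → F),
      eLpNorm g (ENNReal.ofReal q) κ ^ q = ∫⁻ z, ‖g z‖ₑ ^ q ∂κ := fun κ g ↦ by
    rw [key, ← ENNReal.rpow_mul, one_div_mul_cancel hq0.ne', ENNReal.rpow_one]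
  have hm2 : AEStronglyMeasurable (fun w : (Space N × ℝ) × Space N ↦ f (w.1.1 - w.2, w.1.2))
      (((volume : Measure (Space N)).prod ν).prod P) :=
    hf.comp_quasiMeasurePreserving quasiMeasurePreserving_sub_fst
  rw [← ENNReal.rpow_le_rpow_iff hq0, key2]
  calc _ ≤ ∫⁻ z, ∫⁻ y, ‖f (z.1 - y, z.2) - f z‖ₑ ^ q ∂P ∂((volume : Measure (Space N)).prod ν) := by
        refine lintegral_mono_ae ?_
        filter_upwards [hm2.prodMk_left] with z hz
        rw [mollify_eq_integral_withDensity hc h0, ← key2]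
        gcongr
        exact enorm_integral_sub_le_eLpNorm hz _ (by simpa using hq)
    _ = ∫⁻ y, ∫⁻ z, ‖f (z.1 - y, z.2) - f z‖ₑ ^ q ∂((volume : Measure (Space N)).prod ν) ∂P := by
        refine lintegral_lintegral_swap ?_
        exact ((hm2.sub hf.comp_fst).enorm.pow_const q)
    _ ≤ ∫⁻ y, ε ^ q ∂P := by
        refine lintegral_mono_ae ?_
        have hae : ∀ᵐ y ∂P, ρ y ≠ 0 := by
          rw [hP, ae_withDensity_iff (by fun_prop)]
          refine ae_of_all _ fun y hy h ↦ hy (by simp [h])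
        filter_upwards [hae] with y hy
        rw [← key2]
        gcongr
        exact hε y hy
    _ = ε ^ q := by simp

theorem tendsto_eLpNorm_mollify [CompleteSpace F] {ν : Measure ℝ} [IsFiniteMeasure ν]
    {q : ℝ} (hq : 1 ≤ q)
    {f : Space N × ℝ → F} (hf : MemLp f (ENNReal.ofReal q) ((volume : Measure (Space N)).prod ν))
    {φ : ℕ → ContDiffBump (0 : Space N)} (hφ : Tendsto (fun k ↦ (φ k).rOut) atTop (𝓝 0)) :
    Tendsto (fun k ↦ eLpNorm
      (fun z : Space N × ℝ ↦ mollify ((φ k).normed volume) (fun x ↦ f (x, z.2)) z.1 - f z)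
      (ENNReal.ofReal q) ((volume : Measure (Space N)).prod ν)) atTop (𝓝 0) := by
  have h := tendsto_eLpNorm_comp_sub_fst (by simpa using hq) ENNReal.ofReal_ne_top hf
  rw [ENNReal.tendsto_nhds_zero] at h ⊢
  intro ε hε
  obtain ⟨δ, hδ, hb⟩ := Metric.eventually_nhds_iff.1 (h ε hε)
  filter_upwards [hφ.eventually (gt_mem_nhds hδ)] with k hk
  refine eLpNorm_mollify_sub_le hq hf.1 (φ k).continuous_normed (φ k).nonneg_normed
    (φ k).integral_normed fun y hy ↦ hb ?_
  have : y ∈ Function.support ((φ k).normed volume) := hy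
  rw [(φ k).support_normed_eq] at this
  exact lt_trans (by simpa using this) hk

end

/-! ### Gradients of mollified functions. -/

section

variable {N : ℕ} {ρ : Space N → ℝ}

theorem inner_gradient (f : Space N → ℝ) (x v : Space N) :
    inner ℝ (gradient f x) v = fderiv ℝ f x v := by
  rw [gradient, InnerProductSpace.toDual_symm_apply]

theorem norm_gradient (f : Space N → ℝ) (x : Space N) : ‖gradient f x‖ = ‖fderiv ℝ f x‖ := by
  rw [gradient, LinearIsometryEquiv.norm_map]

theorem continuous_gradient {f : Space N → ℝ} (hf : ContDiff ℝ 1 f) : Continuous (gradient f) :=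
  (InnerProductSpace.toDual ℝ (Space N)).symm.continuous.comp (hf.continuous_fderiv one_ne_zero)

theorem measurable_gradient (f : Space N → ℝ) : Measurable (gradient f) :=
  (InnerProductSpace.toDual ℝ (Space N)).symm.continuous.measurable.comp (measurable_fderiv ℝ f)

theorem gradient_eq_zero_of_notMem_tsupport {f : Space N → ℝ} {x : Space N} (hx : x ∉ tsupport f) :
    gradient f x = 0 := by
  have h : f =ᶠ[𝓝 x] 0 := notMem_tsupport_iff_eventuallyEq.1 hx
  rw [gradient, h.fderiv_eq]
  simp

theorem exists_norm_gradient_le {f : Space N → ℝ} (hf : ContDiff ℝ 1 f) (hc : HasCompactSupport f) :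
    ∃ C, 0 ≤ C ∧ ∀ x, ‖gradient f x‖ ≤ C := by
  obtain ⟨C, hC⟩ := (hc.fderiv (𝕜 := ℝ)).exists_bound_of_continuous
    (hf.continuous_fderiv one_ne_zero)
  exact ⟨C, (norm_nonneg _).trans (hC 0), fun x ↦ by rw [norm_gradient]; exact hC x⟩

theorem gradient_comp_const_sub (hρ : ContDiff ℝ 1 ρ) (x z : Space N) :
    gradient (fun z ↦ ρ (x - z)) z = - gradient ρ (x - z) := by
  have h1 : HasFDerivAt ρ (fderiv ℝ ρ (x - z)) (x - z) :=
    (hρ.differentiable one_ne_zero _).hasFDerivAt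
  have h2 : fderiv ℝ (fun z ↦ ρ (x - z)) z = - fderiv ℝ ρ (x - z) := by
    refine (h1.comp z ((hasFDerivAt_id z).const_sub x)).fderiv.trans ?_
    ext; simp
  rw [gradient, h2, map_neg, gradient]

theorem hasGradientAt_mollify (hρ : ContDiff ℝ 1 ρ) (hc : HasCompactSupport ρ) {f : Space N → ℝ}
    (hf : Integrable f) (x : Space N) :
    HasGradientAt (mollify ρ f) (∫ z, f z • gradient ρ (x - z)) x := by
  obtain ⟨C, hC0, hC⟩ := exists_norm_gradient_le hρ hc
  obtain ⟨D, hD⟩ := hc.exists_bound_of_continuous hρ.continuous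
  have hcf : Continuous (fderiv ℝ ρ) := hρ.continuous_fderiv one_ne_zero
  have key := hasFDerivAt_integral_of_dominated_of_fderiv_le (μ := volume) (𝕜 := ℝ)
    (F := fun x z ↦ ρ (x - z) • f z) (F' := fun x z ↦ f z • fderiv ℝ ρ (x - z)) (x₀ := x)
    (s := univ) (bound := fun z ↦ C * ‖f z‖) univ_mem
    (Eventually.of_forall fun x ↦
      (show Continuous fun z ↦ ρ (x - z) from hρ.continuous.comp (by fun_prop)).aestronglyMeasurable.smul hf.1)
    (hf.bdd_mul (c := D)
      (show Continuous fun z ↦ ρ (x - z) from hρ.continuous.comp (by fun_prop)).aestronglyMeasurable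
      (ae_of_all _ fun z ↦ hD _))
    (hf.1.smul (show Continuous fun z ↦ fderiv ℝ ρ (x - z) from hcf.comp (by fun_prop)).aestronglyMeasurable)
    (ae_of_all _ fun z x _ ↦ by
      rw [norm_smul, mul_comm, ← norm_gradient]
      gcongr; exact hC _)
    (hf.norm.const_mul C)
    (ae_of_all _ fun z x _ ↦ by
      have h1 : HasFDerivAt ρ (fderiv ℝ ρ (x - z)) (x - z) :=
        (hρ.differentiable one_ne_zero _).hasFDerivAt
      have h2 := (h1.comp x ((hasFDerivAt_id x).sub_const z)).mul_const (f z)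
      simpa [Function.comp_def, mul_comm] using h2)
  rw [hasGradientAt_iff_hasFDerivAt]
  have e : InnerProductSpace.toDual ℝ (Space N) (∫ z, f z • gradient ρ (x - z)) =
      ∫ z, f z • fderiv ℝ ρ (x - z) := by
    have := ContinuousLinearEquiv.integral_comp_comm (μ := volume)
      (InnerProductSpace.toDual ℝ (Space N)).toContinuousLinearEquiv
      (fun z ↦ f z • gradient ρ (x - z))
    simp only [LinearIsometryEquiv.coe_toContinuousLinearEquiv, gradient] at this
    simp only [gradient]
    rw [← this]
    refine integral_congr_ae (ae_of_all _ fun z ↦ ?_)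
    simp
  rw [e]
  exact key

/-- The reflected translate `z ↦ ρ (x - z)` is an admissible test function for the weak gradient as
long as its support stays in `O`. -/
theorem hasGradientAt_mollify_of_weakGradient (hρ : ContDiff ℝ ∞ ρ) (hc : HasCompactSupport ρ)
    {f : Space N → ℝ} {G : Space N → Space N} {O : Set (Space N)} (hf : Integrable f)
    (hG : ∀ φ : Space N → ℝ, ContDiff ℝ ∞ φ → HasCompactSupport φ → tsupport φ ⊆ O →
      ∫ z, f z • gradient φ z = - ∫ z, φ z • G z) {x : Space N}
    (hx : tsupport (fun z ↦ ρ (x - z)) ⊆ O) :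
    HasGradientAt (mollify ρ f) (mollify ρ G x) x := by
  have h := hasGradientAt_mollify (hρ.of_le (by simp)) hc hf x
  have e := hG (fun z ↦ ρ (x - z)) (hρ.comp (by fun_prop))
    (hc.comp_homeomorph (Homeomorph.subLeft x)) hx
  simp only [gradient_comp_const_sub (hρ.of_le (by simp)), smul_neg, integral_neg, neg_inj] at e
  rwa [e] at h

/-- For fixed `z` the vector `F z` is constant, so the derivative moves from `ρ` to `ψ` by ordinary
integration by parts in `x`, with Fubini before and after. Differentiability of `ψ` and a gradient
bound suffice, which suits `ψ = η g(w)` with `w` a mollified solution. -/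
theorem integral_mul_integral_inner_gradient (hρ : ContDiff ℝ 1 ρ) (hc : HasCompactSupport ρ)
    {F : Space N → Space N} (hF : Integrable F) {ψ : Space N → ℝ} (hψ : Differentiable ℝ ψ)
    (hψc : HasCompactSupport ψ) {C : ℝ} (hC : ∀ x, ‖gradient ψ x‖ ≤ C) :
    ∫ x, ψ x * ∫ z, inner ℝ (F z) (gradient ρ (x - z)) =
      - ∫ x, inner ℝ (mollify ρ F x) (gradient ψ x) := by
  obtain ⟨D, hD0, hD⟩ := exists_norm_gradient_le hρ hc
  obtain ⟨B, hB⟩ := hc.exists_bound_of_continuous hρ.continuous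
  have hψi : Integrable ψ := hψ.continuous.integrable_of_hasCompactSupport hψc
  have hgi : Integrable (gradient ψ) := by
    refine Measure.integrableOn_of_bounded (s := tsupport ψ) (M := C) ?_ (measurable_gradient ψ).aestronglyMeasurable
      (ae_of_all _ hC) |>.integrable_of_forall_notMem_eq_zero
      fun x hx ↦ gradient_eq_zero_of_notMem_tsupport hx
    exact hψc.isCompact.measure_lt_top.ne
  have i1 : Integrable (fun w : Space N × Space N ↦ ψ w.1 * inner ℝ (F w.2) (gradient ρ (w.1 - w.2)))
      (volume.prod volume) := by
    refine ((hψi.mul_prod hF.norm).mul_const D).mono ?_ (ae_of_all _ fun w ↦ ?_)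
    · exact hψi.1.comp_fst.mul (hF.1.comp_snd.inner ((continuous_gradient hρ).comp (by fun_prop : Continuous fun w : Space N × Space N ↦ w.1 - w.2)).aestronglyMeasurable)
    · simp only [norm_mul, norm_norm]
      rw [mul_assoc]
      gcongr
      exact (norm_inner_le_norm _ _).trans (by rw [Real.norm_of_nonneg hD0]; gcongr; exact hD _)
  have i2 : Integrable (fun w : Space N × Space N ↦ ρ (w.1 - w.2) * inner ℝ (F w.2) (gradient ψ w.1))
      (volume.prod volume) := by
    refine (((hgi.norm.mul_prod hF.norm)).const_mul B).mono ?_ (ae_of_all _ fun w ↦ ?_)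
    · exact (hρ.continuous.comp (by fun_prop : Continuous fun w : Space N × Space N ↦ w.1 - w.2)).aestronglyMeasurable.mul
        (hF.1.comp_snd.inner hgi.1.comp_fst)
    · simp only [norm_mul, norm_norm]
      have hB0 : 0 ≤ B := (norm_nonneg _).trans (hB 0)
      rw [Real.norm_of_nonneg hB0]
      gcongr
      · exact hB _
      · rw [mul_comm]; exact norm_inner_le_norm _ _
  have ibp : ∀ z, ∫ x, ψ x * inner ℝ (F z) (gradient ρ (x - z)) =
      - ∫ x, ρ (x - z) * inner ℝ (F z) (gradient ψ x) := fun z ↦ by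
    have hd : ∀ x, fderiv ℝ (fun x ↦ ρ (x - z)) x = fderiv ℝ ρ (x - z) := fun x ↦ by
      rw [fderiv_comp_sub]
    have hcρ : Continuous fun x ↦ ρ (x - z) := hρ.continuous.comp (by fun_prop)
    have hcg : Continuous fun x ↦ fderiv ℝ ρ (x - z) (F z) :=
      ((hρ.continuous_fderiv one_ne_zero).comp (by fun_prop)).clm_apply continuous_const
    have := integral_mul_fderiv_eq_neg_fderiv_mul_of_integrable (μ := volume) (f := ψ)
      (g := fun x ↦ ρ (x - z)) (v := F z) ?_ ?_ ?_ (fun x _ ↦ hψ x)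
      (fun x _ ↦ (hρ.differentiable one_ne_zero _).comp x (by fun_prop))
    · simp only [hd] at this
      simp only [← inner_gradient, real_inner_comm (F z)] at this
      simp only [mul_comm (ρ _)]
      exact this
    · have : Integrable (fun x ↦ inner ℝ (gradient ψ x) (F z)) := hgi.inner_const _
      simp only [← inner_gradient]
      exact this.mul_bdd (c := B) hcρ.aestronglyMeasurable (ae_of_all _ fun x ↦ hB _)
    · simp only [hd]
      exact (hψ.continuous.mul hcg).integrable_of_hasCompactSupport hψc.mul_right
    · exact (hψ.continuous.mul hcρ).integrable_of_hasCompactSupport hψc.mul_right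
  simp_rw [← integral_const_mul]
  rw [integral_integral_swap i1]
  simp_rw [ibp]
  rw [integral_neg, ← integral_integral_swap i2]
  congr 1
  refine integral_congr_ae (ae_of_all _ fun x ↦ ?_)
  have hi : Integrable (fun z ↦ ρ (x - z) • F z) :=
    hF.bdd_smul B (hρ.continuous.comp (continuous_const.sub continuous_id)).aestronglyMeasurable (ae_of_all _ fun z ↦ hB _)
  simp only [mollify]
  rw [real_inner_comm, ← integral_inner hi]
  simp [inner_smul_right]

end

/-! ### Limits of products and measurability of Carathéodory compositions. -/

section

variable {α H : Type*} [MeasurableSpace α] {κ : Measure α} [NormedAddCommGroup H]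
  [InnerProductSpace ℝ H] {p q : ENNReal} [ENNReal.HolderTriple p q 1]

theorem eLpNorm_inner_le {a b : α → H} (ha : AEStronglyMeasurable a κ)
    (hb : AEStronglyMeasurable b κ) :
    eLpNorm (fun z ↦ inner ℝ (a z) (b z)) 1 κ ≤ eLpNorm a p κ * eLpNorm b q κ := by
  simpa using eLpNorm_le_eLpNorm_mul_eLpNorm_of_nnnorm (p := p) (q := q) (r := 1) ha hb
    (fun x y ↦ inner ℝ x y) 1 (ae_of_all _ fun z ↦ by simpa using nnnorm_inner_le_nnnorm (𝕜 := ℝ) (a z) (b z))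

/-- Bilinear expansion leaves three error terms, each small by Hölder. -/
theorem tendsto_eLpNorm_inner_sub {a b : α → H} {a' b' : ℕ → α → H} (ha : MemLp a p κ)
    (hb : MemLp b q κ) (ha' : ∀ k, AEStronglyMeasurable (a' k) κ)
    (hb' : ∀ k, AEStronglyMeasurable (b' k) κ)
    (hta : Tendsto (fun k ↦ eLpNorm (fun z ↦ a' k z - a z) p κ) atTop (𝓝 0))
    (htb : Tendsto (fun k ↦ eLpNorm (fun z ↦ b' k z - b z) q κ) atTop (𝓝 0)) :
    Tendsto (fun k ↦ eLpNorm (fun z ↦ inner ℝ (a' k z) (b' k z) - inner ℝ (a z) (b z)) 1 κ)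
      atTop (𝓝 0) := by
  have h1 := ENNReal.Tendsto.mul hta (Or.inr (by simp)) htb (Or.inr (by simp))
  have h2 := ENNReal.Tendsto.mul_const (b := eLpNorm b q κ) hta (Or.inr hb.2.ne)
  have h3 := ENNReal.Tendsto.const_mul (a := eLpNorm a p κ) htb (Or.inr ha.2.ne)
  have h4 := (h1.add h2).add h3
  simp only [mul_zero, zero_mul, add_zero] at h4
  refine tendsto_of_tendsto_of_tendsto_of_le_of_le tendsto_const_nhds h4 (fun k ↦ zero_le)
    fun k ↦ ?_
  have e : (fun z ↦ inner ℝ (a' k z) (b' k z) - inner ℝ (a z) (b z)) =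
      ((fun z ↦ inner ℝ (a' k z - a z) (b' k z - b z)) + fun z ↦ inner ℝ (a' k z - a z) (b z)) +
        fun z ↦ inner ℝ (a z) (b' k z - b z) := by
    ext z
    simp only [Pi.add_apply, inner_sub_left, inner_sub_right]
    ring
  have hA := (ha' k).sub ha.1
  have hB := (hb' k).sub hb.1
  rw [e]
  refine (eLpNorm_add_le ((hA.inner hB).add (hA.inner hb.1)) (ha.1.inner hB) le_rfl).trans ?_
  refine add_le_add ((eLpNorm_add_le (hA.inner hB) (hA.inner hb.1) le_rfl).trans ?_) ?_
  · exact add_le_add (eLpNorm_inner_le hA hB) (eLpNorm_inner_le hA hb.1)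
  · exact eLpNorm_inner_le ha.1 hB

/-- Split `c' h' - c h = c' (h' - h) + (c' - c) h`: the first term is small because `c'` is bounded,
the second by dominated convergence. -/
theorem tendsto_integral_mul_of_tendsto_eLpNorm {h : α → ℝ} {h' : ℕ → α → ℝ} {c : α → ℝ}
    {c' : ℕ → α → ℝ} {C : ℝ} (hh : Integrable h κ) (hh' : ∀ k, AEStronglyMeasurable (h' k) κ)
    (hc' : ∀ k, AEStronglyMeasurable (c' k) κ)
    (hC : ∀ k, ∀ᵐ z ∂κ, ‖c' k z‖ ≤ C)
    (hlim : ∀ᵐ z ∂κ, Tendsto (fun k ↦ c' k z) atTop (𝓝 (c z)))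
    (ht : Tendsto (fun k ↦ eLpNorm (fun z ↦ h' k z - h z) 1 κ) atTop (𝓝 0)) :
    Tendsto (fun k ↦ ∫ z, c' k z * h' k z ∂κ) atTop (𝓝 (∫ z, c z * h z ∂κ)) := by
  have hCae : ∀ᵐ z ∂κ, ∀ k, ‖c' k z‖ ≤ C := ae_all_iff.2 hC
  have t1 : Tendsto (fun k ↦ ∫ z, c' k z * h z ∂κ) atTop (𝓝 (∫ z, c z * h z ∂κ)) := by
    refine tendsto_integral_of_dominated_convergence (fun z ↦ C * ‖h z‖)
      (fun k ↦ (hc' k).mul hh.1) (hh.norm.const_mul C) (fun k ↦ ?_) ?_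
    · filter_upwards [hC k] with z hz
      rw [norm_mul]; gcongr
    · filter_upwards [hlim] with z hz using hz.mul_const _
  have hfin : ∀ᶠ k in atTop, eLpNorm (fun z ↦ h' k z - h z) 1 κ < ⊤ :=
    ht.eventually_lt_const (by simp)
  have t2 : Tendsto (fun k ↦ ∫ z, c' k z * (h' k z - h z) ∂κ) atTop (𝓝 0) := by
    have ht' : Tendsto (fun k ↦ ENNReal.ofReal C * eLpNorm (fun z ↦ h' k z - h z) 1 κ) atTop (𝓝 0) := by
      simpa using ENNReal.Tendsto.const_mul (a := ENNReal.ofReal C) ht (Or.inr (by simp))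
    rw [tendsto_iff_edist_tendsto_0]
    refine tendsto_of_tendsto_of_tendsto_of_le_of_le tendsto_const_nhds ht' (fun k ↦ zero_le)
      fun k ↦ ?_
    rw [edist_zero_right]
    refine (enorm_integral_le_lintegral_enorm _).trans ?_
    rw [eLpNorm_one_eq_lintegral_enorm, ← lintegral_const_mul' _ _ (by simp)]
    refine lintegral_mono_ae ?_
    filter_upwards [hC k] with z hz
    rw [enorm_mul]
    gcongr
    rw [← ofReal_norm]
    exact ENNReal.ofReal_le_ofReal hz
  have := t1.add t2
  rw [add_zero] at this
  refine this.congr' ?_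
  filter_upwards [hfin] with k hk
  have hi : Integrable (fun z ↦ h' k z - h z) κ :=
    memLp_one_iff_integrable.1 ⟨(hh' k).sub hh.1, hk⟩
  rw [← integral_add (hh.bdd_mul (c := C) (hc' k) (hC k)) (hi.bdd_mul (c := C) (hc' k) (hC k))]
  refine integral_congr_ae (ae_of_all _ fun z ↦ ?_)
  simp only
  ring

/-- Off one null set, measurability on a countable dense set of `(v, ξ)` and continuity in `(v, ξ)`
give a jointly measurable version, which may be composed. -/
theorem aestronglyMeasurable_comp_of_caratheodory {X Y : Type*} [NormedAddCommGroup X]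
    [MeasurableSpace X] [BorelSpace X] [SecondCountableTopology X]
    [NormedAddCommGroup Y] {A : α → ℝ → X → Y}
    (hA : ∀ v : ℝ, 0 ≤ v → ∀ ξ : X, AEStronglyMeasurable (fun z ↦ A z v ξ) κ)
    (hc : ∀ᵐ z ∂κ, ContinuousOn (fun w : ℝ × X ↦ A z w.1 w.2) (Ici 0 ×ˢ univ))
    {u : α → ℝ} {V : α → X} (hu : AEStronglyMeasurable u κ) (hu0 : ∀ᵐ z ∂κ, 0 ≤ u z)
    (hV : AEStronglyMeasurable V κ) : AEStronglyMeasurable (fun z ↦ A z (u z) (V z)) κ := by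
  -- The absolute value turns continuity on the half-line into continuity everywhere; since `u ≥ 0`
  -- almost everywhere, it does not affect the composition.
  set B : α → ℝ × X → Y := fun z w ↦ A z |w.1| w.2 with hB
  have hBm : ∀ w, AEStronglyMeasurable (fun z ↦ B z w) κ := fun w ↦ hA _ (abs_nonneg _) _
  have hBc : ∀ᵐ z ∂κ, Continuous (B z) := by
    filter_upwards [hc] with z hz
    exact hz.comp_continuous (f := fun w : ℝ × X ↦ (|w.1|, w.2)) (by fun_prop) (fun w ↦ by simp)
  set d : ℕ → ℝ × X := TopologicalSpace.denseSeq (ℝ × X) with hd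
  have hall : ∀ᵐ z ∂κ, Continuous (B z) ∧ ∀ n, B z (d n) = (hBm (d n)).mk _ z :=
    hBc.and (ae_all_iff.2 fun n ↦ (hBm (d n)).ae_eq_mk)
  obtain ⟨S, hS, hSm, hS0⟩ : ∃ S ⊆ {z | Continuous (B z) ∧ ∀ n, B z (d n) = (hBm (d n)).mk _ z},
      MeasurableSet S ∧ κ Sᶜ = 0 := by
    obtain ⟨t, ht, htm, ht0⟩ := exists_measurable_superset_of_null hall
    exact ⟨tᶜ, by rwa [compl_subset_comm], htm.compl, by rwa [compl_compl]⟩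
  classical
  set B' : ℝ × X → α → Y := fun w z ↦ S.indicator (fun z ↦ B z w) z with hB'
  have hB'c : ∀ z, Continuous fun w ↦ B' w z := fun z ↦ by
    by_cases hz : z ∈ S
    · simpa [hB', hz] using (hS hz).1
    · simpa [hB', hz] using continuous_const
  have hB'd : ∀ n, StronglyMeasurable (B' (d n)) := fun n ↦ by
    have : B' (d n) = S.indicator ((hBm (d n)).mk _) := by
      refine indicator_congr fun z hz ↦ (hS hz).2 n
    rw [this]
    exact (hBm (d n)).stronglyMeasurable_mk.indicator hSm
  have hB'm : ∀ w, StronglyMeasurable (B' w) := fun w ↦ by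
    obtain ⟨x, hx, hxt⟩ := mem_closure_iff_seq_limit.1
      ((TopologicalSpace.denseRange_denseSeq (ℝ × X)) w)
    refine stronglyMeasurable_of_tendsto (u := atTop) (f := fun k ↦ B' (x k)) (fun k ↦ ?_)
      (tendsto_pi_nhds.2 fun z ↦ ((hB'c z).tendsto w).comp hxt)
    obtain ⟨n, hn⟩ := hx k
    rw [← hn]; exact hB'd n
  have hunc := stronglyMeasurable_uncurry_of_continuous_of_stronglyMeasurable hB'c hB'm
  have hcomp : StronglyMeasurable (fun z ↦ B' (hu.mk u z, hV.mk V z) z) :=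
    hunc.comp_measurable (((hu.stronglyMeasurable_mk.measurable).prodMk
      hV.stronglyMeasurable_mk.measurable).prodMk measurable_id)
  refine ⟨_, hcomp, ?_⟩
  have hSae : ∀ᵐ z ∂κ, z ∈ S := hS0
  filter_upwards [hSae, hu0, hu.ae_eq_mk, hV.ae_eq_mk] with z hz h0 h1 h2
  rw [← h1, ← h2]
  simp [hB', hz, hB, abs_of_nonneg h0]

end

/-! ### The mollified equation. -/

section

variable {N : ℕ} {ρ : Space N → ℝ}

/-- A bounded function `U` with weak spatial gradient `V` that satisfies `U_t = div F` weakly in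
`O × (t₁, t₂)`; the functions are defined, and integrable, on the whole space. -/
structure IsDivergenceSolution (O : Set (Space N)) (t₁ t₂ μ p q : ℝ) (U : Space N → ℝ → ℝ)
    (F V : Space N → ℝ → Space N) : Prop where
  le : t₁ ≤ t₂
  integrable_slice : ∀ t ∈ Icc t₁ t₂, Integrable (fun x ↦ U x t)
  bound : ∀ t ∈ Icc t₁ t₂, ∀ᵐ x, x ∈ O → U x t ∈ Icc 0 μ
  integrable : Integrable (fun z : Space N × ℝ ↦ U z.1 z.2)
    (volume.prod (volume.restrict (Ioc t₁ t₂)))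
  integrable_flux : Integrable (fun z : Space N × ℝ ↦ F z.1 z.2)
    (volume.prod (volume.restrict (Ioc t₁ t₂)))
  memLp_flux : MemLp (fun z : Space N × ℝ ↦ F z.1 z.2) (ENNReal.ofReal q)
    (volume.prod (volume.restrict (Ioc t₁ t₂)))
  memLp_grad : MemLp (fun z : Space N × ℝ ↦ V z.1 z.2) (ENNReal.ofReal p)
    (volume.prod (volume.restrict (Ioc t₁ t₂)))
  weak : ∀ φ : Space N → ℝ, ContDiff ℝ ∞ φ → HasCompactSupport φ → tsupport φ ⊆ O →
    (∀ x, 0 ≤ φ x) → ∀ t ∈ Icc t₁ t₂,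
      (∫ x, U x t * φ x) - ∫ x, U x t₁ * φ x = - ∫ τ in t₁..t, ∫ x, inner ℝ (F x τ) (gradient φ x)
  grad : ∀ᵐ t ∂volume.restrict (Ioc t₁ t₂), ∀ φ : Space N → ℝ, ContDiff ℝ ∞ φ →
    HasCompactSupport φ → tsupport φ ⊆ O →
      ∫ x, U x t • gradient φ x = - ∫ x, φ x • V x t

theorem integral_comp_const_sub_eq_one (h1 : ∫ x, ρ x = 1) (x : Space N) : ∫ z, ρ (x - z) = 1 := by
  rw [integral_sub_left_eq_self ρ volume x, h1]

theorem mollify_mem_Icc (hρc : Continuous ρ) (hρs : HasCompactSupport ρ) (h0 : ∀ x, 0 ≤ ρ x)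
    (h1 : ∫ x, ρ x = 1) {f : Space N → ℝ} (hf : Integrable f) {O : Set (Space N)} {μ : ℝ}
    (hb : ∀ᵐ x, x ∈ O → f x ∈ Icc 0 μ) {x : Space N} (hx : tsupport (fun z ↦ ρ (x - z)) ⊆ O) :
    mollify ρ f x ∈ Icc 0 μ := by
  obtain ⟨B, hB⟩ := hρs.exists_bound_of_continuous hρc
  have hcx : Continuous fun z ↦ ρ (x - z) := hρc.comp (by fun_prop)
  have hzero : ∀ z, z ∉ O → ρ (x - z) = 0 := fun z hz ↦
    image_eq_zero_of_notMem_tsupport (f := fun z ↦ ρ (x - z)) fun h ↦ hz (hx h)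
  constructor
  · refine integral_nonneg_of_ae ?_
    filter_upwards [hb] with z hz
    by_cases h : z ∈ O
    · exact mul_nonneg (h0 _) (hz h).1
    · simp [hzero z h]
  · calc mollify ρ f x ≤ ∫ z, ρ (x - z) * μ := by
          refine integral_mono_ae (hf.bdd_smul B hcx.aestronglyMeasurable (ae_of_all _ fun z ↦ hB _))
            ?_ ?_
          · exact ((hcx.integrable_of_hasCompactSupport
              (hρs.comp_homeomorph (Homeomorph.subLeft x))).mul_const μ)
          · filter_upwards [hb] with z hz
            by_cases h : z ∈ O
            · exact mul_le_mul_of_nonneg_left (hz h).2 (h0 _)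
            · simp [hzero z h]
      _ = μ := by rw [integral_mul_const, integral_comp_const_sub_eq_one h1, one_mul]

theorem aestronglyMeasurable_integral_comp_sub {H H' : Type*} [NormedAddCommGroup H]
    [NormedSpace ℝ H] [NormedAddCommGroup H'] [NormedSpace ℝ H']
    {ν : Measure ℝ} [IsFiniteMeasure ν] {f : Space N × ℝ → H}
    (hf : AEStronglyMeasurable f ((volume : Measure (Space N)).prod ν)) {k : H → Space N → H'}
    (hk : Continuous (Function.uncurry k)) :
    AEStronglyMeasurable (fun w : Space N × ℝ ↦ ∫ y, k (f (w.1 - y, w.2)) y)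
      ((volume : Measure (Space N)).prod ν) := by
  have hm2 : AEStronglyMeasurable (fun w : (Space N × ℝ) × Space N ↦ f (w.1.1 - w.2, w.1.2))
      (((volume : Measure (Space N)).prod ν).prod volume) :=
    hf.comp_quasiMeasurePreserving quasiMeasurePreserving_sub_fst
  have : AEStronglyMeasurable (fun w : (Space N × ℝ) × Space N ↦ k (f (w.1.1 - w.2, w.1.2)) w.2)
      (((volume : Measure (Space N)).prod ν).prod volume) :=
    hk.comp_aestronglyMeasurable (hm2.prodMk measurable_snd.aestronglyMeasurable)
  exact this.integral_prod_right'

theorem aestronglyMeasurable_mollify {H : Type*} [NormedAddCommGroup H] [NormedSpace ℝ H]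
    {ν : Measure ℝ} [IsFiniteMeasure ν] {f : Space N × ℝ → H}
    (hf : AEStronglyMeasurable f ((volume : Measure (Space N)).prod ν)) (hρ : Continuous ρ) :
    AEStronglyMeasurable (fun w : Space N × ℝ ↦ mollify ρ (fun x ↦ f (x, w.2)) w.1)
      ((volume : Measure (Space N)).prod ν) := by
  simp only [mollify_eq]
  exact aestronglyMeasurable_integral_comp_sub (k := fun h y ↦ ρ y • h) hf
    ((hρ.comp continuous_snd).smul continuous_fst)

variable {O : Set (Space N)} {t₁ t₂ μ p q : ℝ} {U : Space N → ℝ → ℝ} {F V : Space N → ℝ → Space N}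

/-- Testing with a translate of the kernel makes the mollified solution a primitive in time at each
fixed `x`, so no regularization in time is needed. -/
theorem IsDivergenceSolution.mollify_sub (h : IsDivergenceSolution O t₁ t₂ μ p q U F V)
    (hρ : ContDiff ℝ ∞ ρ) (hρs : HasCompactSupport ρ) (h0 : ∀ x, 0 ≤ ρ x) {x : Space N}
    (hx : tsupport (fun z ↦ ρ (x - z)) ⊆ O) {t : ℝ} (ht : t ∈ Icc t₁ t₂) :
    mollify ρ (fun z ↦ U z t) x - mollify ρ (fun z ↦ U z t₁) x =
      ∫ τ in t₁..t, ∫ z, inner ℝ (F z τ) (gradient ρ (x - z)) := by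
  have := h.weak (fun z ↦ ρ (x - z)) (hρ.comp (by fun_prop))
    (hρs.comp_homeomorph (Homeomorph.subLeft x)) hx (fun z ↦ h0 _) t ht
  simp only [gradient_comp_const_sub (hρ.of_le (by simp)), inner_neg_right, integral_neg,
    intervalIntegral.integral_neg, neg_neg] at this
  simp only [mollify, smul_eq_mul, mul_comm (ρ _)]
  exact this

theorem abs_integral_inner_gradient_le {D : ℝ} (hD : ∀ x, ‖gradient ρ x‖ ≤ D) {f : Space N → Space N}
    (hf : Integrable f) (x : Space N) :
    ‖∫ z, inner ℝ (f z) (gradient ρ (x - z))‖ ≤ D * ∫ z, ‖f z‖ := by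
  rw [← integral_const_mul]
  refine norm_integral_le_of_norm_le (hf.norm.const_mul D) (ae_of_all _ fun z ↦ ?_)
  refine (norm_inner_le_norm _ _).trans ?_
  rw [mul_comm]
  gcongr
  exact hD _

theorem IsDivergenceSolution.integrable_integral_inner
    (h : IsDivergenceSolution O t₁ t₂ μ p q U F V)
    (hρ : ContDiff ℝ 1 ρ) (hρs : HasCompactSupport ρ) (x : Space N) :
    Integrable (fun τ ↦ ∫ z, inner ℝ (F z τ) (gradient ρ (x - z)))
      (volume.restrict (Ioc t₁ t₂)) := by
  obtain ⟨D, hD0, hD⟩ := exists_norm_gradient_le hρ hρs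
  have hc : Continuous fun z ↦ gradient ρ (x - z) := (continuous_gradient hρ).comp (by fun_prop)
  have : Integrable (fun w : Space N × ℝ ↦ inner ℝ (F w.1 w.2) (gradient ρ (x - w.1)))
      (volume.prod (volume.restrict (Ioc t₁ t₂))) := by
    refine (h.integrable_flux.norm.const_mul D).mono' ?_ (ae_of_all _ fun w ↦ ?_)
    · exact h.integrable_flux.1.inner (hc.comp continuous_fst).aestronglyMeasurable
    · refine (norm_inner_le_norm _ _).trans ?_
      rw [mul_comm]
      gcongr
      exact hD _
  exact this.integral_prod_right

/-- The identity obtained by testing the mollified equation with `g (u_ρ) η`. -/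
theorem IsDivergenceSolution.mollified_identity (h : IsDivergenceSolution O t₁ t₂ μ p q U F V)
    (hρ : ContDiff ℝ ∞ ρ) (hρs : HasCompactSupport ρ) (h0 : ∀ x, 0 ≤ ρ x) (h1 : ∫ x, ρ x = 1)
    {η : Space N → ℝ} (hη : ContDiff ℝ 1 η) (hηs : HasCompactSupport η)
    (hηO : ∀ x ∈ tsupport η, tsupport (fun z ↦ ρ (x - z)) ⊆ O) {Φ g g' : ℝ → ℝ}
    (hΦ : ∀ v ∈ Icc 0 μ, HasDerivAt Φ (g v) v) (hg : ∀ v ∈ Icc 0 μ, HasDerivAt g (g' v) v)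
    (hgc : Continuous g) (hgc' : Continuous g') :
    ∫ x, η x * (Φ (mollify ρ (fun z ↦ U z t₂) x) - Φ (mollify ρ (fun z ↦ U z t₁) x)) =
      - ∫ τ in Ioc t₁ t₂, ∫ x, (η x * g' (mollify ρ (fun z ↦ U z τ) x) *
          inner ℝ (mollify ρ (fun z ↦ F z τ) x) (mollify ρ (fun z ↦ V z τ) x) +
        (tsupport η).indicator 1 x * g (mollify ρ (fun z ↦ U z τ) x) *
          inner ℝ (mollify ρ (fun z ↦ F z τ) x) (gradient η x)) := by
  have hρ1 : ContDiff ℝ 1 ρ := hρ.of_le (by simp)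
  obtain ⟨D, hD0, hD⟩ := exists_norm_gradient_le hρ1 hρs
  obtain ⟨C, hC⟩ := isCompact_Icc.exists_bound_of_continuousOn (hgc.continuousOn (s := Icc 0 μ))
  obtain ⟨C', hC'⟩ := isCompact_Icc.exists_bound_of_continuousOn (hgc'.continuousOn (s := Icc 0 μ))
  have hmem : ∀ τ ∈ Icc t₁ t₂, ∀ x ∈ tsupport η, mollify ρ (fun z ↦ U z τ) x ∈ Icc 0 μ :=
    fun τ hτ x hx ↦ mollify_mem_Icc hρ.continuous hρs h0 h1 (h.integrable_slice τ hτ)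
      (h.bound τ hτ) (hηO x hx)
  have hηi : Integrable η := hη.continuous.integrable_of_hasCompactSupport hηs
  -- The chain rule in time at a fixed `x`; off `tsupport η` both sides vanish.
  have e1 : ∀ x, η x * (Φ (mollify ρ (fun z ↦ U z t₂) x) - Φ (mollify ρ (fun z ↦ U z t₁) x)) =
      ∫ τ in Ioc t₁ t₂, η x * g (mollify ρ (fun z ↦ U z τ) x) *
        ∫ z, inner ℝ (F z τ) (gradient ρ (x - z)) := fun x ↦ by
    by_cases hx : x ∈ tsupport η
    · rw [integral_comp_mul_of_primitive (h := fun t ↦ mollify ρ (fun z ↦ U z t) x)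
        (b := fun τ ↦ ∫ z, inner ℝ (F z τ) (gradient ρ (x - z))) h.le hΦ hgc.continuousOn
        (fun τ hτ ↦ hmem τ hτ x hx)
        ((intervalIntegrable_iff_integrableOn_Ioc_of_le h.le).2
          (h.integrable_integral_inner hρ1 hρs x))
        (fun t ht ↦ h.mollify_sub hρ hρs h0 (hηO x hx) ht),
        intervalIntegral.integral_of_le h.le, ← integral_const_mul]
      simp only [mul_assoc]
    · simp [image_eq_zero_of_notMem_tsupport hx]
  have hmeas : AEStronglyMeasurable (fun w : Space N × ℝ ↦ η w.1 * g (mollify ρ (fun z ↦ U z w.2) w.1) *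
        ∫ z, inner ℝ (F z w.2) (gradient ρ (w.1 - z)))
      (volume.prod (volume.restrict (Ioc t₁ t₂))) := by
    refine ((hη.continuous.comp continuous_fst).aestronglyMeasurable.mul
      (hgc.comp_aestronglyMeasurable (aestronglyMeasurable_mollify h.integrable.1
        hρ.continuous))).mul ?_
    have := aestronglyMeasurable_integral_comp_sub (k := fun v y ↦ inner ℝ v (gradient ρ y))
      h.integrable_flux.1 (continuous_fst.inner ((continuous_gradient hρ1).comp continuous_snd))
    refine this.congr (ae_of_all _ fun w ↦ ?_)
    beta_reduce
    rw [← integral_sub_left_eq_self _ volume w.1]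
    simp
  have hFs : ∀ᵐ τ ∂volume.restrict (Ioc t₁ t₂), Integrable (fun z ↦ F z τ) :=
    h.integrable_flux.prod_left_ae
  have hbd : Integrable (fun w : Space N × ℝ ↦ η w.1 * g (mollify ρ (fun z ↦ U z w.2) w.1) *
        ∫ z, inner ℝ (F z w.2) (gradient ρ (w.1 - z)))
      (volume.prod (volume.restrict (Ioc t₁ t₂))) := by
    have hn : Integrable (fun τ ↦ ∫ z, ‖F z τ‖) (volume.restrict (Ioc t₁ t₂)) :=
      h.integrable_flux.norm.integral_prod_right
    refine ((hηi.norm.mul_prod hn).const_mul (C * D)).mono' hmeas ?_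
    have hae : ∀ᵐ w : Space N × ℝ ∂(volume.prod (volume.restrict (Ioc t₁ t₂))),
        w.2 ∈ Ioc t₁ t₂ ∧ Integrable (fun z ↦ F z w.2) :=
      Measure.quasiMeasurePreserving_snd.ae ((ae_restrict_mem measurableSet_Ioc).and hFs)
    filter_upwards [hae] with w hw
    by_cases hx : w.1 ∈ tsupport η
    · rw [norm_mul, norm_mul]
      have b1 := abs_integral_inner_gradient_le hD hw.2 w.1
      have b2 := hC _ (hmem w.2 (Ioc_subset_Icc_self hw.1) w.1 hx)
      have b3 : 0 ≤ C := (norm_nonneg _).trans b2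
      calc _ ≤ ‖η w.1‖ * C * (D * ∫ z, ‖F z w.2‖) := by gcongr
        _ = _ := by ring
    · simp [image_eq_zero_of_notMem_tsupport hx]
  simp_rw [e1]
  rw [integral_integral_swap hbd, ← integral_neg]
  refine integral_congr_ae ?_
  filter_upwards [hFs, h.grad, ae_restrict_mem measurableSet_Ioc] with τ hF hG hτ
  have hτ' := Ioc_subset_Icc_self hτ
  have hUi := h.integrable_slice τ hτ'
  set w := mollify ρ (fun z ↦ U z τ) with hw
  have hwd : ∀ x, HasGradientAt w (gradient w x) x := fun x ↦
    (hasGradientAt_mollify hρ1 hρs hUi x).differentiableAt.hasGradientAt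
  have hwV : ∀ x ∈ tsupport η, HasGradientAt w (mollify ρ (fun z ↦ V z τ) x) x := fun x hx ↦
    hasGradientAt_mollify_of_weakGradient hρ hρs hUi hG (hηO x hx)
  have hψ : ∀ x ∈ tsupport η, HasGradientAt (fun x ↦ η x * g (w x))
      (η x • g' (w x) • mollify ρ (fun z ↦ V z τ) x + g (w x) • gradient η x) x := fun x hx ↦ by
    have d1 : HasFDerivAt η (fderiv ℝ η x) x := (hη.differentiable one_ne_zero x).hasFDerivAt
    have d2 := (hg _ (hmem τ hτ' x hx)).comp_hasFDerivAt x (hasGradientAt_iff_hasFDerivAt.1 (hwV x hx))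
    rw [hasGradientAt_iff_hasFDerivAt]
    refine (d1.mul d2).congr_fderiv ?_
    rw [gradient]
    simp only [map_add, map_smul, LinearIsometryEquiv.apply_symm_apply, Function.comp]
    rfl
  have hψ0 : ∀ x, x ∉ tsupport η → (fun x ↦ η x * g (w x)) =ᶠ[𝓝 x] 0 := fun x hx ↦ by
    filter_upwards [notMem_tsupport_iff_eventuallyEq.1 hx] with y hy
    simp [hy]
  have hψd : Differentiable ℝ (fun x ↦ η x * g (w x)) := fun x ↦ by
    by_cases hx : x ∈ tsupport η
    · exact (hψ x hx).differentiableAt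
    · exact ((hψ0 x hx).differentiableAt_iff).2 (differentiableAt_const 0)
  -- The indicator costs nothing, because `∇η` vanishes off `tsupport η`. It keeps the coefficient
  -- `g (w x)` bounded: no pointwise bound on `U` is assumed outside `O`.
  have hψg : ∀ x, gradient (fun x ↦ η x * g (w x)) x =
      η x • g' (w x) • mollify ρ (fun z ↦ V z τ) x +
        ((tsupport η).indicator 1 x * g (w x)) • gradient η x := fun x ↦ by
    by_cases hx : x ∈ tsupport η
    · rw [(hψ x hx).gradient]; simp [hx]
    · rw [gradient, (hψ0 x hx).fderiv_eq]
      simp [hx, image_eq_zero_of_notMem_tsupport hx]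
  obtain ⟨Cη, hCη0, hCη⟩ := exists_norm_gradient_le hη hηs
  obtain ⟨B, hB⟩ := hηs.exists_bound_of_continuous hη.continuous
  have hB0 : 0 ≤ B := (norm_nonneg _).trans (hB 0)
  have hgw : ∀ x, ‖gradient w x‖ ≤ D * ∫ z, ‖U z τ‖ := fun x ↦ by
    rw [(hasGradientAt_mollify hρ1 hρs hUi x).gradient, ← integral_const_mul]
    refine norm_integral_le_of_norm_le (hUi.norm.const_mul D) (ae_of_all _ fun z ↦ ?_)
    rw [norm_smul, mul_comm]
    gcongr
    exact hD _
  have key := integral_mul_integral_inner_gradient hρ1 hρs hF hψd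
    (hηs.mul_right) (C := max 0 (B * (C' * (D * ∫ z, ‖U z τ‖)) + C * Cη)) (fun x ↦ by
      by_cases hx : x ∈ tsupport η
      · refine le_max_of_le_right ?_
        rw [(hψ x hx).gradient, ← (hwV x hx).gradient]
        have hm := hmem τ hτ' x hx
        have c1 := hC _ hm
        have c2 := hC' _ hm
        have c3 : 0 ≤ C' := (norm_nonneg _).trans c2
        have c4 : 0 ≤ C := (norm_nonneg _).trans c1
        refine (norm_add_le _ _).trans ?_
        simp only [norm_smul]
        gcongr
        · exact hB x
        · exact hgw x
        · exact hCη x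
      · rw [gradient, (hψ0 x hx).fderiv_eq]
        simp)
  rw [key]
  congr 1
  refine integral_congr_ae (ae_of_all _ fun x ↦ ?_)
  simp only [hψg, inner_add_right, inner_smul_right]
  ring

end

/-! ### Removing the mollifier: the energy identity. -/

section

variable {N : ℕ} {O : Set (Space N)} {t₁ t₂ μ p q : ℝ} {U : Space N → ℝ → ℝ} {F V : Space N → ℝ → Space N}

/-- The bounded ratio of the radii is what Lebesgue differentiation along the kernels requires. -/
theorem exists_contDiffBump_seq (N : ℕ) {δ : ℝ} (hδ : 0 < δ) : ∃ φ : ℕ → ContDiffBump (0 : Space N),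
    (∀ k, (φ k).rOut ≤ δ) ∧ (∀ k, (φ k).rOut ≤ 2 * (φ k).rIn) ∧
      Tendsto (fun k ↦ (φ k).rOut) atTop (𝓝 0) := by
  refine ⟨fun k ↦ ⟨δ / (k + 1) / 2, δ / (k + 1), by positivity, half_lt_self (by positivity)⟩,
    fun k ↦ div_le_self hδ.le (by linarith [k.cast_nonneg (α := ℝ)]), fun k ↦ ?_, ?_⟩
  · simp only; linarith
  · refine ((tendsto_const_div_atTop_nhds_zero_nat δ).comp (tendsto_add_atTop_nat 1)).congr fun k ↦ ?_
    simp

theorem ae_tendsto_mollify {φ : ℕ → ContDiffBump (0 : Space N)}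
    (hφ : Tendsto (fun k ↦ (φ k).rOut) atTop (𝓝 0)) (hφ' : ∀ k, (φ k).rOut ≤ 2 * (φ k).rIn)
    {f : Space N → ℝ} (hf : Integrable f) :
    ∀ᵐ x, Tendsto (fun k ↦ mollify ((φ k).normed volume) f x) atTop (𝓝 (f x)) := by
  filter_upwards [ContDiffBump.ae_convolution_tendsto_right_of_locallyIntegrable (μ := volume)
    hφ (Eventually.of_forall hφ') hf.locallyIntegrable] with x hx
  refine hx.congr fun k ↦ ?_
  rw [mollify_eq]
  rfl

theorem tendsto_integral_mul_comp_mollify {φ : ℕ → ContDiffBump (0 : Space N)}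
    (hφ : Tendsto (fun k ↦ (φ k).rOut) atTop (𝓝 0)) (hφ' : ∀ k, (φ k).rOut ≤ 2 * (φ k).rIn)
    {f : Space N → ℝ} (hf : Integrable f) (hb : ∀ᵐ x, x ∈ O → f x ∈ Icc 0 μ)
    {η : Space N → ℝ} (hη : Continuous η) (hηs : HasCompactSupport η)
    (hηO : ∀ k, ∀ x ∈ tsupport η, tsupport (fun z ↦ (φ k).normed volume (x - z)) ⊆ O)
    {Φ : ℝ → ℝ} (hΦ : Continuous Φ) :
    Tendsto (fun k ↦ ∫ x, η x * Φ (mollify ((φ k).normed volume) f x)) atTop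
      (𝓝 (∫ x, η x * Φ (f x))) := by
  obtain ⟨C, hC⟩ := isCompact_Icc.exists_bound_of_continuousOn (hΦ.continuousOn (s := Icc 0 μ))
  have hρ : ∀ k, ContDiff ℝ 1 ((φ k).normed volume) := fun k ↦ (φ k).contDiff_normed (n := 1)
  have hηi : Integrable η := hη.integrable_of_hasCompactSupport hηs
  refine tendsto_integral_of_dominated_convergence (fun x ↦ ‖η x‖ * C) (fun k ↦ ?_)
    (hηi.norm.mul_const C) (fun k ↦ ae_of_all _ fun x ↦ ?_) ?_
  · have : Continuous (mollify ((φ k).normed volume) f) := continuous_iff_continuousAt.2 fun x ↦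
      (hasGradientAt_mollify (hρ k) (φ k).hasCompactSupport_normed hf x).continuousAt
    exact (hη.mul (hΦ.comp this)).aestronglyMeasurable
  · by_cases hx : x ∈ tsupport η
    · rw [norm_mul]
      gcongr
      exact hC _ (mollify_mem_Icc (hρ k).continuous (φ k).hasCompactSupport_normed
        (φ k).nonneg_normed (φ k).integral_normed hf hb (hηO k x hx))
    · simp [image_eq_zero_of_notMem_tsupport hx]
  · filter_upwards [ae_tendsto_mollify hφ hφ' hf] with x hx
    exact ((hΦ.tendsto _).comp hx).const_mul _

theorem exists_seq_tendsto_mollify_ae {φ : ℕ → ContDiffBump (0 : Space N)}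
    {ν : Measure ℝ} [IsFiniteMeasure ν] {f : Space N × ℝ → ℝ}
    (hf : Integrable f ((volume : Measure (Space N)).prod ν))
    (hφ : Tendsto (fun k ↦ (φ k).rOut) atTop (𝓝 0)) :
    ∃ ns : ℕ → ℕ, StrictMono ns ∧ ∀ᵐ z ∂(volume : Measure (Space N)).prod ν,
      Tendsto (fun k ↦ mollify ((φ (ns k)).normed volume) (fun x ↦ f (x, z.2)) z.1) atTop
        (𝓝 (f z)) := by
  have h1 := tendsto_eLpNorm_mollify (q := 1) le_rfl
    (by simpa using memLp_one_iff_integrable.2 hf) hφ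
  have h2 : TendstoInMeasure ((volume : Measure (Space N)).prod ν)
      (fun k (z : Space N × ℝ) ↦ mollify ((φ k).normed volume) (fun x ↦ f (x, z.2)) z.1) atTop f :=
    tendstoInMeasure_of_tendsto_eLpNorm (p := ENNReal.ofReal 1) (by simp)
      (fun k ↦ aestronglyMeasurable_mollify hf.1 (φ k).continuous_normed) hf.1 h1
  exact h2.exists_seq_tendsto_ae

/-- The energy identity: testing the equation with `g (U) η`. -/
theorem IsDivergenceSolution.energy_identity (h : IsDivergenceSolution O t₁ t₂ μ p q U F V)
    (hO : IsOpen O) (hpq : p.HolderConjugate q)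
    {η : Space N → ℝ} (hη : ContDiff ℝ 1 η) (hηs : HasCompactSupport η)
    (hηO : tsupport η ⊆ O) {Φ g g' : ℝ → ℝ}
    (hΦ : ∀ v ∈ Icc 0 μ, HasDerivAt Φ (g v) v) (hg : ∀ v ∈ Icc 0 μ, HasDerivAt g (g' v) v)
    (hΦc : Continuous Φ) (hgc : Continuous g) (hgc' : Continuous g') :
    (∫ x, η x * Φ (U x t₂)) - ∫ x, η x * Φ (U x t₁) =
      - ((∫ z : Space N × ℝ, η z.1 * g' (U z.1 z.2) * inner ℝ (F z.1 z.2) (V z.1 z.2)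
          ∂(volume.prod (volume.restrict (Ioc t₁ t₂)))) +
        ∫ z : Space N × ℝ, (tsupport η).indicator 1 z.1 * g (U z.1 z.2) *
          inner ℝ (F z.1 z.2) (gradient η z.1) ∂(volume.prod (volume.restrict (Ioc t₁ t₂)))) := by
  set m : Measure (Space N × ℝ) := volume.prod (volume.restrict (Ioc t₁ t₂)) with hm
  -- All kernels centred on `tsupport η` with radius at most `δ` keep their support in `O`.
  obtain ⟨δ, hδ, hδO⟩ := hηs.isCompact.exists_cthickening_subset_open hO hηO
  obtain ⟨φ₀, h1₀, h2₀, h3₀⟩ := exists_contDiffBump_seq N hδ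
  have hp1 : 1 ≤ p := hpq.lt.le
  have hq1 : 1 ≤ q := hpq.symm.lt.le
  have : ENNReal.HolderTriple (ENNReal.ofReal q) (ENNReal.ofReal p) 1 := hpq.symm.ennrealOfReal
  -- Almost everywhere convergence in space-time is extracted from `L¹` convergence, whence the
  -- subsequence. At the fixed times `t₁`, `t₂` Lebesgue differentiation is used instead.
  obtain ⟨ns, hns, hlim₀⟩ := exists_seq_tendsto_mollify_ae h.integrable h3₀
  set φ : ℕ → ContDiffBump (0 : Space N) := fun k ↦ φ₀ (ns k) with hφ
  have h1 : ∀ k, (φ k).rOut ≤ δ := fun k ↦ h1₀ _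
  have h2 : ∀ k, (φ k).rOut ≤ 2 * (φ k).rIn := fun k ↦ h2₀ _
  have h3 : Tendsto (fun k ↦ (φ k).rOut) atTop (𝓝 0) := h3₀.comp hns.tendsto_atTop
  have hsupp : ∀ k, ∀ x ∈ tsupport η, tsupport (fun z ↦ (φ k).normed volume (x - z)) ⊆ O := by
    intro k x hx
    refine Subset.trans ?_ hδO
    refine closure_minimal (fun z hz ↦ ?_) Metric.isClosed_cthickening
    have hz' : x - z ∈ Function.support ((φ k).normed volume) := hz
    rw [(φ k).support_normed_eq] at hz'
    refine Metric.mem_cthickening_of_dist_le z x δ _ hx ?_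
    rw [dist_comm, dist_eq_norm]
    exact (by simpa using hz' : ‖x - z‖ < (φ k).rOut).le.trans (h1 k)
  have hρ : ∀ k, ContDiff ℝ ∞ ((φ k).normed volume) := fun k ↦ (φ k).contDiff_normed (n := ⊤)
  set Uk : ℕ → Space N × ℝ → ℝ := fun k z ↦ mollify ((φ k).normed volume) (fun x ↦ U x z.2) z.1
    with hUk
  set Fk : ℕ → Space N × ℝ → Space N := fun k z ↦ mollify ((φ k).normed volume) (fun x ↦ F x z.2) z.1
    with hFk
  set Vk : ℕ → Space N × ℝ → Space N := fun k z ↦ mollify ((φ k).normed volume) (fun x ↦ V x z.2) z.1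
    with hVk
  have hUm : ∀ k, AEStronglyMeasurable (Uk k) m := fun k ↦
    aestronglyMeasurable_mollify h.integrable.1 (φ k).continuous_normed
  have hFm : ∀ k, AEStronglyMeasurable (Fk k) m := fun k ↦
    aestronglyMeasurable_mollify h.integrable_flux.1 (φ k).continuous_normed
  have hVm : ∀ k, AEStronglyMeasurable (Vk k) m := fun k ↦
    aestronglyMeasurable_mollify h.memLp_grad.1 (φ k).continuous_normed
  have hlim : ∀ᵐ z ∂m, Tendsto (fun k ↦ Uk k z) atTop (𝓝 (U z.1 z.2)) := hlim₀
  have tF : Tendsto (fun k ↦ eLpNorm (fun z ↦ Fk k z - F z.1 z.2) (ENNReal.ofReal q) m)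
    atTop (𝓝 0) := tendsto_eLpNorm_mollify hq1 h.memLp_flux h3
  have tV : Tendsto (fun k ↦ eLpNorm (fun z ↦ Vk k z - V z.1 z.2) (ENNReal.ofReal p) m)
    atTop (𝓝 0) := tendsto_eLpNorm_mollify hp1 h.memLp_grad h3
  have hfin : IsFiniteMeasure (volume.restrict (Ioc t₁ t₂)) := inferInstance
  have hgradp : MemLp (fun z : Space N × ℝ ↦ gradient η z.1) (ENNReal.ofReal p) m :=
    (((continuous_gradient hη).memLp_of_hasCompactSupport (p := ENNReal.ofReal p) (μ := volume)
      (HasCompactSupport.of_support_subset_isCompact hηs.isCompact fun x hx ↦ by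
        by_contra hx'
        exact hx (gradient_eq_zero_of_notMem_tsupport hx')))).comp_fst _
  have t1 := tendsto_eLpNorm_inner_sub h.memLp_flux h.memLp_grad hFm hVm tF tV
  have t2 := tendsto_eLpNorm_inner_sub h.memLp_flux hgradp hFm (fun _ ↦ hgradp.1) tF (by simp)
  have i1 : Integrable (fun z : Space N × ℝ ↦ inner ℝ (F z.1 z.2) (V z.1 z.2)) m :=
    memLp_one_iff_integrable.1 ⟨h.memLp_flux.1.inner h.memLp_grad.1,
      (eLpNorm_inner_le (p := ENNReal.ofReal q) (q := ENNReal.ofReal p) h.memLp_flux.1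
        h.memLp_grad.1).trans_lt (ENNReal.mul_lt_top h.memLp_flux.2 h.memLp_grad.2)⟩
  have i2 : Integrable (fun z : Space N × ℝ ↦ inner ℝ (F z.1 z.2) (gradient η z.1)) m :=
    memLp_one_iff_integrable.1 ⟨h.memLp_flux.1.inner hgradp.1,
      (eLpNorm_inner_le (p := ENNReal.ofReal q) (q := ENNReal.ofReal p) h.memLp_flux.1
        hgradp.1).trans_lt (ENNReal.mul_lt_top h.memLp_flux.2 hgradp.2)⟩
  have hmemU : ∀ k, ∀ᵐ z ∂m, z.1 ∈ tsupport η → Uk k z ∈ Icc 0 μ := fun k ↦ by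
    have : ∀ᵐ z : Space N × ℝ ∂m, z.2 ∈ Ioc t₁ t₂ :=
      Measure.quasiMeasurePreserving_snd.ae (ae_restrict_mem measurableSet_Ioc)
    filter_upwards [this] with z hz hx
    have hz' := Ioc_subset_Icc_self hz
    exact mollify_mem_Icc (hρ k).continuous (φ k).hasCompactSupport_normed
      (φ k).nonneg_normed (φ k).integral_normed (h.integrable_slice _ hz') (h.bound _ hz')
      (hsupp k _ hx)
  obtain ⟨B, hB⟩ := hηs.exists_bound_of_continuous hη.continuous
  have hB0 : 0 ≤ B := (norm_nonneg _).trans (hB 0)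
  obtain ⟨C, hC⟩ := isCompact_Icc.exists_bound_of_continuousOn (hgc.continuousOn (s := Icc 0 μ))
  obtain ⟨C', hC'⟩ := isCompact_Icc.exists_bound_of_continuousOn (hgc'.continuousOn (s := Icc 0 μ))
  have hindm : AEStronglyMeasurable (fun z : Space N × ℝ ↦ (tsupport η).indicator (1 : Space N → ℝ) z.1) m :=
    ((measurable_one.indicator (isClosed_tsupport η).measurableSet).comp
      measurable_fst).aestronglyMeasurable
  have m1 : ∀ k, AEStronglyMeasurable (fun z ↦ η z.1 * g' (Uk k z)) m := fun k ↦
    (hη.continuous.comp continuous_fst).aestronglyMeasurable.mul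
      (hgc'.comp_aestronglyMeasurable (hUm k))
  have m2 : ∀ k, AEStronglyMeasurable
      (fun z ↦ (tsupport η).indicator (1 : Space N → ℝ) z.1 * g (Uk k z)) m := fun k ↦
    hindm.mul (hgc.comp_aestronglyMeasurable (hUm k))
  have b1 : ∀ k, ∀ᵐ z ∂m, ‖η z.1 * g' (Uk k z)‖ ≤ max 0 (B * C') := fun k ↦ by
    filter_upwards [hmemU k] with z hz
    by_cases hx : z.1 ∈ tsupport η
    · refine le_max_of_le_right ?_
      rw [norm_mul]
      gcongr
      · exact hB _
      · exact hC' _ (hz hx)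
    · simp [image_eq_zero_of_notMem_tsupport hx]
  have b2 : ∀ k, ∀ᵐ z ∂m,
      ‖(tsupport η).indicator (1 : Space N → ℝ) z.1 * g (Uk k z)‖ ≤ max 0 C := fun k ↦ by
    filter_upwards [hmemU k] with z hz
    by_cases hx : z.1 ∈ tsupport η
    · refine le_max_of_le_right ?_
      simpa [hx] using hC _ (hz hx)
    · simp [hx]
  have T1 := tendsto_integral_mul_of_tendsto_eLpNorm i1 (fun k ↦ (hFm k).inner (hVm k)) m1 b1
    (c := fun z ↦ η z.1 * g' (U z.1 z.2))
    (by filter_upwards [hlim] with z hz using ((hgc'.tendsto _).comp hz).const_mul _) t1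
  have T2 := tendsto_integral_mul_of_tendsto_eLpNorm i2 (fun k ↦ (hFm k).inner hgradp.1) m2 b2
    (c := fun z ↦ (tsupport η).indicator (1 : Space N → ℝ) z.1 * g (U z.1 z.2))
    (by filter_upwards [hlim] with z hz using ((hgc.tendsto _).comp hz).const_mul _) t2
  have T3 := tendsto_integral_mul_comp_mollify h3 h2 (h.integrable_slice t₂ (right_mem_Icc.2 h.le))
    (h.bound t₂ (right_mem_Icc.2 h.le)) hη.continuous hηs hsupp hΦc
  have T4 := tendsto_integral_mul_comp_mollify h3 h2 (h.integrable_slice t₁ (left_mem_Icc.2 h.le))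
    (h.bound t₁ (left_mem_Icc.2 h.le)) hη.continuous hηs hsupp hΦc
  refine tendsto_nhds_unique (T3.sub T4) ((T1.add T2).neg.congr' ?_)
  -- A finite `L¹` distance makes the mollified products integrable, as is needed to split and
  -- iterate the integrals.
  have f1 : ∀ᶠ k in atTop, eLpNorm (fun z : Space N × ℝ ↦ inner ℝ (Fk k z) (Vk k z) -
      inner ℝ (F z.1 z.2) (V z.1 z.2)) 1 m < ⊤ := t1.eventually_lt_const (by simp)
  have f2 : ∀ᶠ k in atTop, eLpNorm (fun z : Space N × ℝ ↦ inner ℝ (Fk k z) (gradient η z.1) -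
      inner ℝ (F z.1 z.2) (gradient η z.1)) 1 m < ⊤ := t2.eventually_lt_const (by simp)
  filter_upwards [f1, f2] with k hk1 hk2
  have j1 : Integrable (fun z ↦ inner ℝ (Fk k z) (Vk k z)) m := by
    have := (memLp_one_iff_integrable.1 ⟨((hFm k).inner (hVm k)).sub i1.1, hk1⟩).add i1
    exact this.congr (ae_of_all _ fun z ↦ by simp)
  have j2 : Integrable (fun z ↦ inner ℝ (Fk k z) (gradient η z.1)) m := by
    have := (memLp_one_iff_integrable.1 ⟨((hFm k).inner hgradp.1).sub i2.1, hk2⟩).add i2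
    exact this.congr (ae_of_all _ fun z ↦ by simp)
  have k1 := j1.bdd_mul (m1 k) (b1 k)
  have k2 := j2.bdd_mul (m2 k) (b2 k)
  have e := h.mollified_identity (hρ k) (φ k).hasCompactSupport_normed
        (φ k).nonneg_normed (φ k).integral_normed hη hηs (hsupp k) hΦ hg hgc hgc'
  have e2 := integral_prod_symm _ (k1.add k2)
  simp only [Pi.add_apply] at e2
  rw [← integral_add k1 k2, hm, e2]
  simp only [hUk, hFk, hVk]
  rw [← e]
  have hl : ∀ t ∈ Icc t₁ t₂, Integrable (fun x ↦ η x * Φ (mollify ((φ k).normed volume) (fun z ↦ U z t) x)) := by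
    intro t ht
    have : Continuous (mollify ((φ k).normed volume) (fun z ↦ U z t)) :=
      continuous_iff_continuousAt.2 fun x ↦ (hasGradientAt_mollify ((hρ k).of_le (by simp))
        (φ k).hasCompactSupport_normed (h.integrable_slice t ht) x).continuousAt
    exact (hη.continuous.mul (hΦc.comp this)).integrable_of_hasCompactSupport hηs.mul_right
  rw [← integral_sub (hl t₂ (right_mem_Icc.2 h.le)) (hl t₁ (left_mem_Icc.2 h.le))]
  simp only [mul_sub]

end

/-! ### From weak solutions to equations in divergence form. -/

section

variable {N : ℕ} {Ω : Set (Space N)} {T m p K₁ K₂ : ℝ}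
  {A : Space N → ℝ → ℝ → Space N → Space N} {u : Space N → ℝ → ℝ} {V : Space N → ℝ → Space N}

theorem mMinus_of_one_le (hm : 1 ≤ m) : mMinus m = 1 := min_eq_left hm

theorem spatialGradient_of_one_le (hm : 1 ≤ m) : spatialGradient m u V = V := by
  ext x t
  simp [spatialGradient, mMinus_of_one_le hm]

theorem gradPow_of_one_le (hm : 1 ≤ m) (v : ℝ) (ξ : Space N) : gradPow m v ξ = ξ := by
  simp [gradPow, mMinus_of_one_le hm]

/-- As `(m-1)(p-1) > 0`, the growth bound forces `A z 0 ξ = 0` by continuity, so both conditions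
persist at `v = 0`. -/
theorem StructureConditions.extend (hA : IsCaratheodory Ω T A)
    (h : StructureConditions Ω T m p K₁ K₂ A) (hm : 1 < m) (hp : 1 < p) :
    ∀ᵐ z ∂(volume.restrict (spaceTime Ω T)), ∀ v : ℝ, 0 ≤ v → ∀ ξ : Space N,
      ‖A z.1 z.2 v ξ‖ ≤ K₂ * v ^ ((m - 1) * (p - 1)) * ‖ξ‖ ^ (p - 1) ∧
      K₁ * v ^ ((m - 1) * (p - 1)) * ‖ξ‖ ^ p ≤ inner ℝ (A z.1 z.2 v ξ) ξ := by
  have he : 0 < (m - 1) * (p - 1) := mul_pos (by linarith) (by linarith)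
  filter_upwards [h.growth, h.coercive, hA.continuous] with z h1 h2 h3 v hv ξ
  simp only [gradPow_of_one_le hm.le, mMinus_of_one_le hm.le] at h1 h2
  rcases hv.lt_or_eq with hv | rfl
  · exact ⟨h1 v hv ξ, h2 v hv ξ⟩
  · have hz : A z.1 z.2 0 ξ = 0 := by
      have c1 : Tendsto (fun v : ℝ ↦ A z.1 z.2 v ξ) (𝓝[>] 0) (𝓝 (A z.1 z.2 0 ξ)) := by
        have := (h3 (0, ξ) ⟨self_mem_Ici, mem_univ _⟩).tendsto
        refine this.comp (f := fun v : ℝ ↦ (v, ξ)) (tendsto_nhdsWithin_iff.2 ⟨?_, ?_⟩)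
        · exact ((continuous_id.prodMk continuous_const).tendsto' (0 : ℝ) (0, ξ) rfl).mono_left
            nhdsWithin_le_nhds
        · filter_upwards [self_mem_nhdsWithin] with v hv
          exact ⟨mem_Ici.2 (le_of_lt hv), mem_univ _⟩
      have c2 : Tendsto (fun v : ℝ ↦ K₂ * v ^ ((m - 1) * (p - 1)) * ‖ξ‖ ^ (p - 1)) (𝓝[>] 0) (𝓝 0) := by
        have : Tendsto (fun v : ℝ ↦ K₂ * v ^ ((m - 1) * (p - 1)) * ‖ξ‖ ^ (p - 1)) (𝓝 0)
            (𝓝 (K₂ * 0 ^ ((m - 1) * (p - 1)) * ‖ξ‖ ^ (p - 1))) :=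
          (((Real.continuousAt_rpow_const _ _ (Or.inr he.le)).tendsto).const_mul _).mul_const _
        rw [Real.zero_rpow he.ne', mul_zero, zero_mul] at this
        exact this.mono_left nhdsWithin_le_nhds
      refine tendsto_nhds_unique c1 (squeeze_zero_norm' ?_ c2)
      filter_upwards [self_mem_nhdsWithin] with v hv using h1 v hv ξ
    rw [hz, Real.zero_rpow he.ne']
    simp

theorem isTestFunction_const {E : Set (Space N)} (hE : IsCompact E)
    {φ : Space N → ℝ} (hφ : ContDiff ℝ ∞ φ) (hφs : HasCompactSupport φ)
    (hφE : tsupport φ ⊆ interior E) (h0 : ∀ x, 0 ≤ φ x) :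
    IsTestFunction m p T E (fun x _ ↦ φ x) (fun _ _ ↦ 0) (fun x _ ↦ gradient φ x) := by
  have hφ1 : ContDiff ℝ 1 φ := hφ.of_le (by simp)
  obtain ⟨B, hB⟩ := hφs.exists_bound_of_continuous hφ.continuous
  obtain ⟨C, -, hC⟩ := exists_norm_gradient_le hφ1 hφs
  have hfin : IsFiniteMeasure (volume.restrict (E ×ˢ Ioo 0 T)) := by
    refine ⟨?_⟩
    rw [Measure.restrict_apply_univ, Measure.volume_eq_prod, Measure.prod_prod]
    exact ENNReal.mul_lt_top hE.measure_lt_top (by simp)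
  have hfin' : IsFiniteMeasure (volume.restrict E) := ⟨by simpa using hE.measure_lt_top⟩
  have e1 : ∀ q : ENNReal, MemLp (fun z : Space N × ℝ ↦ φ z.1) q (volume.restrict (E ×ˢ Ioo 0 T)) :=
    fun q ↦ MemLp.of_bound (hφ.continuous.comp continuous_fst).aestronglyMeasurable B
      (ae_of_all _ fun z ↦ hB _)
  refine ⟨e1 _, MemLp.zero', fun t₁ _ t₂ _ _ ↦ by simp, e1 _, ?_, ?_,
    fun t _ ↦ ae_of_all _ h0⟩
  · exact MemLp.of_bound ((continuous_gradient hφ1).comp continuous_fst).aestronglyMeasurable C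
      (ae_of_all _ fun z ↦ hC _)
  · refine ae_of_all _ fun t ↦ ⟨MemLp.of_bound hφ.continuous.aestronglyMeasurable B
      (ae_of_all _ hB), MemLp.of_bound (continuous_gradient hφ1).aestronglyMeasurable C
      (ae_of_all _ hC), fun _ ↦ φ, fun _ ↦ ⟨hφ, hφs, hφE⟩, by simp, by simp⟩

theorem ae_ae_of_ae_restrict_prod {B : Set (Space N)} {I : Set ℝ} {P : Space N × ℝ → Prop}
    (h : ∀ᵐ z ∂volume.restrict (B ×ˢ I), P z) :
    ∀ᵐ t ∂volume.restrict I, ∀ᵐ x ∂volume.restrict B, P (x, t) := by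
  rw [Measure.volume_eq_prod, ← Measure.prod_restrict] at h
  exact Measure.ae_ae_of_ae_prod
    ((Measure.measurePreserving_swap (μ := volume.restrict I)
      (ν := volume.restrict B)).quasiMeasurePreserving.ae h)

/-- The bounds hold for almost every time, hence on a dense set of times. Continuity in time with
values in `L²(K)` (here `m⁻ = 1`) carries them to every time, including `s` and `t` when these lie
in `(0, T)`. -/
theorem IsRegular.slice_mem_Icc (h : IsRegular Ω T m p u V) (hm : 1 ≤ m) {B : Set (Space N)}
    {s t μ : ℝ} (hst : s < t) (hBs : B ×ˢ Ioo s t ⊆ spaceTime Ω T)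
    (hμ : ∀ᵐ z ∂volume.restrict (B ×ˢ Ioo s t), u z.1 z.2 ≤ μ) {K : Set (Space N)}
    (hK : IsCompact K) (hKB : K ⊆ B) (hKΩ : K ⊆ Ω) {τ : ℝ} (hτ : τ ∈ Icc s t ∩ Ioo 0 T) :
    ∀ᵐ x ∂volume.restrict K, u x τ ∈ Icc 0 μ := by
  rcases K.eq_empty_or_nonempty with rfl | ⟨x₀, hx₀⟩
  · simp
  have hI : ∀ σ ∈ Ioo s t, σ ∈ Ioo 0 T := fun σ hσ ↦
    (hBs (show (x₀, σ) ∈ B ×ˢ Ioo s t from ⟨hKB hx₀, hσ⟩)).2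
  have h1 : ∀ᵐ z ∂volume.restrict (B ×ˢ Ioo s t), u z.1 z.2 ∈ Icc 0 μ := by
    filter_upwards [hμ, ae_mono (Measure.restrict_mono hBs le_rfl) h.nonneg] with z h1 h2
    exact ⟨h2, h1⟩
  have h2 := ae_ae_of_ae_restrict_prod h1
  rw [ae_restrict_iff' measurableSet_Ioo] at h2
  have h3 : Dense {σ | σ ∈ Ioo s t → ∀ᵐ x ∂volume.restrict B, u x σ ∈ Icc 0 μ} :=
    Measure.dense_of_ae h2
  have h4 : τ ∈ closure (Ioo s t ∩ {σ | σ ∈ Ioo s t → ∀ᵐ x ∂volume.restrict B, u x σ ∈ Icc 0 μ}) := by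
    have : closure (Ioo s t) ⊆ _ :=
      closure_minimal (h3.open_subset_closure_inter isOpen_Ioo) isClosed_closure
    rw [closure_Ioo hst.ne] at this
    exact this hτ.1
  obtain ⟨σ, hσ, hlim⟩ := mem_closure_iff_seq_limit.1 h4
  have hT := (h.continuous K hK hKΩ τ hτ.2).comp hlim
  have hmeas : TendstoInMeasure (volume.restrict K) (fun n x ↦ u x (σ n)) atTop (fun x ↦ u x τ) :=
    tendstoInMeasure_of_tendsto_eLpNorm (p := ENNReal.ofReal (1 + mMinus m))
      (by rw [mMinus_of_one_le hm]; simp)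
      (fun n ↦ (h.memLp_slice K hK hKΩ (σ n) (hI _ (hσ n).1)).1)
      (h.memLp_slice K hK hKΩ τ hτ.2).1 hT
  obtain ⟨ns, -, hns⟩ := hmeas.exists_seq_tendsto_ae
  have hall : ∀ᵐ x ∂volume.restrict K, ∀ n, u x (σ n) ∈ Icc 0 μ := ae_all_iff.2 fun n ↦
    ae_mono (Measure.restrict_mono hKB le_rfl) ((hσ n).2 (hσ n).1)
  filter_upwards [hns, hall] with x hx1 hx2
  exact isClosed_Icc.mem_of_tendsto hx1 (Eventually.of_forall fun n ↦ hx2 _)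

theorem memLp_indicator_prod {H : Type*} [NormedAddCommGroup H] {E : Set (Space N)}
    (hE : MeasurableSet E) {I : Set ℝ} {f : Space N → ℝ → H} {q : ENNReal} :
    MemLp (fun z : Space N × ℝ ↦ E.indicator (fun x ↦ f x z.2) z.1) q
      (volume.prod (volume.restrict I)) ↔
    MemLp (fun z : Space N × ℝ ↦ f z.1 z.2) q (volume.restrict (E ×ˢ I)) := by
  have e1 : (fun z : Space N × ℝ ↦ E.indicator (fun x ↦ f x z.2) z.1) =
      (E ×ˢ (univ : Set ℝ)).indicator (fun z ↦ f z.1 z.2) := by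
    ext z
    by_cases hz : z.1 ∈ E <;> simp [indicator, hz]
  rw [e1, memLp_indicator_iff_restrict (hE.prod MeasurableSet.univ), Measure.volume_eq_prod,
    ← Measure.prod_restrict, ← Measure.prod_restrict]
  simp

theorem setIntegral_eq_of_tsupport_subset {H : Type*} [NormedAddCommGroup H] [NormedSpace ℝ H]
    {E : Set (Space N)} {f : Space N → H} {K : Set (Space N)}
    (hK : K ⊆ E) (hf : ∀ x ∉ K, f x = 0) : ∫ x in E, f x = ∫ x, f x :=
  setIntegral_eq_integral_of_forall_compl_eq_zero fun x hx ↦ hf x fun h ↦ hx (hK h)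

end

section

variable {N : ℕ} {Ω : Set (Space N)} {T m p K₁ K₂ : ℝ}
  {A : Space N → ℝ → ℝ → Space N → Space N} {u : Space N → ℝ → ℝ}

/-- A weak solution bounded by `μ` in a cylinder, cut off outside of a smaller ball, solves a
divergence form equation whose flux `F` and gradient `V` satisfy the structure conditions. -/
theorem IsWeakSolution.exists_isDivergenceSolution (hm : 1 < m) (hp : 1 < p)
    (hA : IsCaratheodory Ω T A) (hS : StructureConditions Ω T m p K₁ K₂ A) (hK₂ : 0 < K₂)
    (hu : IsWeakSolution Ω T m p A u) {y : Space N} {r s t μ R t₁ t₂ : ℝ}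
    (hst : s < t) (hsub : Metric.ball y r ×ˢ Ioo s t ⊆ spaceTime Ω T)
    (hμ : ∀ᵐ z ∂volume.restrict (Metric.ball y r ×ˢ Ioo s t), u z.1 z.2 ≤ μ)
    (hR : 0 < R) (hRr : R < r) (ht₁ : t₁ ∈ Icc s t ∩ Ioo 0 T) (ht₂ : t₂ ∈ Icc s t ∩ Ioo 0 T)
    (h12 : t₁ ≤ t₂) :
    ∃ F V : Space N → ℝ → Space N,
      IsDivergenceSolution (Metric.ball y R) t₁ t₂ μ p (p / (p - 1))
        (fun x τ ↦ (Metric.closedBall y R).indicator (fun x ↦ u x τ) x) F V ∧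
      ∀ᵐ z ∂(volume : Measure (Space N)).prod (volume.restrict (Ioc t₁ t₂)),
        z.1 ∈ Metric.closedBall y R → u z.1 z.2 ∈ Icc 0 μ ∧
        ‖F z.1 z.2‖ ≤ K₂ * u z.1 z.2 ^ ((m - 1) * (p - 1)) * ‖V z.1 z.2‖ ^ (p - 1) ∧
        K₁ * u z.1 z.2 ^ ((m - 1) * (p - 1)) * ‖V z.1 z.2‖ ^ p ≤
          inner ℝ (F z.1 z.2) (V z.1 z.2) := by
  obtain ⟨V, hV, hw⟩ := hu
  rw [spatialGradient_of_one_le hm.le] at hw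
  set E := Metric.closedBall y R with hE
  have hEm : MeasurableSet E := Metric.isClosed_closedBall.measurableSet
  have hEc : IsCompact E := isCompact_closedBall y R
  have hEB : E ⊆ Metric.ball y r := Metric.closedBall_subset_ball hRr
  have hBΩ : Metric.ball y r ⊆ Ω := fun x hx ↦ by
    obtain ⟨σ, hσ⟩ := nonempty_Ioo.2 hst
    exact (hsub (show (x, σ) ∈ _ ×ˢ _ from ⟨hx, hσ⟩)).1
  have hEΩ := hEB.trans hBΩ
  have hIoo : Ioo t₁ t₂ ⊆ Ioo s t := Ioo_subset_Ioo ht₁.1.1 ht₂.1.2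
  have hIcc : Icc t₁ t₂ ⊆ Icc s t ∩ Ioo 0 T := fun τ hτ ↦
    ⟨⟨ht₁.1.1.trans hτ.1, hτ.2.trans ht₂.1.2⟩, ht₁.2.1.trans_le hτ.1, hτ.2.trans_lt ht₂.2.2⟩
  have hOE : Metric.ball y R ⊆ E := Metric.ball_subset_closedBall
  have hslice : ∀ τ ∈ Icc t₁ t₂, ∀ᵐ x ∂volume.restrict E, u x τ ∈ Icc 0 μ := fun τ hτ ↦
    hV.slice_mem_Icc hm.le hst hsub hμ hEc hEB hEΩ (hIcc hτ)
  have hEpos : volume E ≠ 0 := (Metric.measure_closedBall_pos volume y hR).ne'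
  have hμ0 : 0 ≤ μ := by
    have : NeZero (volume.restrict E) := ⟨by simpa [Measure.restrict_eq_zero] using hEpos⟩
    obtain ⟨x, hx⟩ := (hslice t₁ (left_mem_Icc.2 h12)).exists
    exact hx.1.trans hx.2
  have hfinE : IsFiniteMeasure (volume.restrict E) := ⟨by simpa using hEc.measure_lt_top⟩
  have hres : volume.restrict (E ×ˢ Ioo t₁ t₂) = volume.restrict (E ×ˢ Ioc t₁ t₂) := by
    rw [Measure.volume_eq_prod, ← Measure.prod_restrict, ← Measure.prod_restrict,
      restrict_Ioo_eq_restrict_Ioc]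
  have hle1 : volume.restrict (E ×ˢ Ioc t₁ t₂) ≤ volume.restrict (Metric.ball y r ×ˢ Ioo s t) := by
    rw [← hres]; exact Measure.restrict_mono (Set.prod_mono hEB hIoo) le_rfl
  have hle2 : volume.restrict (E ×ˢ Ioc t₁ t₂) ≤ volume.restrict (spaceTime Ω T) :=
    hle1.trans (Measure.restrict_mono hsub le_rfl)
  have hfinP : IsFiniteMeasure (volume.restrict (E ×ˢ Ioc t₁ t₂)) := by
    refine ⟨?_⟩
    rw [Measure.restrict_apply_univ, Measure.volume_eq_prod, Measure.prod_prod]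
    exact ENNReal.mul_lt_top hEc.measure_lt_top (by simp)
  have hub : ∀ᵐ z ∂volume.restrict (E ×ˢ Ioc t₁ t₂), u z.1 z.2 ∈ Icc 0 μ := by
    filter_upwards [ae_mono hle1 hμ, ae_mono hle2 hV.nonneg] with z h1 h2 using ⟨h2, h1⟩
  have hum : AEStronglyMeasurable (fun z : Space N × ℝ ↦ u z.1 z.2)
      (volume.restrict (E ×ˢ Ioc t₁ t₂)) := hV.measurable.mono_measure hle2
  have hVm : MemLp (fun z : Space N × ℝ ↦ V z.1 z.2) (ENNReal.ofReal p)
      (volume.restrict (E ×ˢ Ioc t₁ t₂)) :=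
    (hV.memLp_grad E hEc hEΩ t₁ t₂ ht₁.2.1 ht₂.2.2).mono_measure
      (Measure.restrict_mono (Set.prod_mono le_rfl Ioc_subset_Icc_self) le_rfl)
  have hstr := ae_mono hle2 (hS.extend hA hm hp)
  have hFm : AEStronglyMeasurable (fun z : Space N × ℝ ↦ A z.1 z.2 (u z.1 z.2) (V z.1 z.2))
      (volume.restrict (E ×ˢ Ioc t₁ t₂)) :=
    aestronglyMeasurable_comp_of_caratheodory (A := fun z : Space N × ℝ ↦ A z.1 z.2)
      (fun v hv ξ ↦ (hA.measurable v hv ξ).mono_measure hle2) (ae_mono hle2 hA.continuous) hum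
      (by filter_upwards [hub] with z hz using hz.1) hVm.1
  have he : 0 < (m - 1) * (p - 1) := mul_pos (by linarith) (by linarith)
  have hp1 : 0 < p - 1 := by linarith
  -- The flux is at most `K₂ μ^((m-1)(p-1)) |V|^(p-1)`, and `|V|^(p-1)` lies in `L^(p/(p-1))`.
  have hF : MemLp (fun z : Space N × ℝ ↦ A z.1 z.2 (u z.1 z.2) (V z.1 z.2))
      (ENNReal.ofReal (p / (p - 1))) (volume.restrict (E ×ˢ Ioc t₁ t₂)) := by
    have h1 := hVm.norm_rpow_div (ENNReal.ofReal (p - 1))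
    rw [ENNReal.toReal_ofReal hp1.le, ← ENNReal.ofReal_div_of_pos hp1] at h1
    refine (h1.const_mul (K₂ * μ ^ ((m - 1) * (p - 1)))).mono hFm ?_
    filter_upwards [hub, hstr] with z h2 h3
    refine (h3 _ h2.1 _).1.trans ?_
    refine le_trans ?_ (le_abs_self _)
    gcongr
    · exact h2.1
    · exact h2.2
  -- Extension by zero permits convolution on the whole space. The jump across the sphere is
  -- invisible to test functions supported in the open ball.
  refine ⟨fun x τ ↦ E.indicator (fun x ↦ A x τ (u x τ) (V x τ)) x,
    fun x τ ↦ E.indicator (fun x ↦ V x τ) x, ⟨h12, ?_, ?_, ?_, ?_, ?_, ?_, ?_, ?_⟩, ?_⟩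
  · intro τ hτ
    rw [integrable_indicator_iff hEm]
    have := hV.memLp_slice E hEc hEΩ τ (hIcc hτ).2
    exact this.integrable (by rw [mMinus_of_one_le hm.le]; simp)
  · intro τ hτ
    filter_upwards [(ae_restrict_iff' hEm).1 (hslice τ hτ)] with x hx hxO
    rw [indicator_of_mem (hOE hxO)]
    exact hx (hOE hxO)
  · rw [← memLp_one_iff_integrable, memLp_indicator_prod hEm]
    refine MemLp.of_bound hum μ ?_
    filter_upwards [hub] with z hz
    rw [Real.norm_of_nonneg hz.1]; exact hz.2
  · rw [← memLp_one_iff_integrable]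
    refine (memLp_indicator_prod (f := fun x τ ↦ A x τ (u x τ) (V x τ)) hEm).2
      (hF.mono_exponent ?_)
    rw [ENNReal.one_le_ofReal, le_div_iff₀ hp1]
    linarith
  · exact (memLp_indicator_prod (f := fun x τ ↦ A x τ (u x τ) (V x τ)) hEm).2 hF
  · rw [memLp_indicator_prod hEm]
    exact hVm
  · intro φ hφ hφs hφO h0 τ hτ
    have hφi : tsupport φ ⊆ interior E := hφO.trans (interior_maximal hOE Metric.isOpen_ball)
    have hφ0 : ∀ x ∉ E, φ x = 0 := fun x hx ↦
      image_eq_zero_of_notMem_tsupport fun h ↦ hx (hOE (hφO h))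
    have key := hw E hEc hEΩ t₁ τ ht₁.2.1 hτ.1 (hIcc hτ).2.2 _ _ _
      (isTestFunction_const hEc hφ hφs hφi h0)
    have hzero := le_antisymm key.1 key.2
    simp only [weakForm, mul_zero, neg_zero, zero_add] at hzero
    have c1 : ∀ σ, ∫ x, E.indicator (fun x ↦ u x σ) x * φ x = ∫ x in E, u x σ * φ x := fun σ ↦ by
      rw [← integral_indicator hEm]
      simp only [← indicator_mul_left]
    have c2 : ∀ σ, ∫ x, inner ℝ (E.indicator (fun x ↦ A x σ (u x σ) (V x σ)) x) (gradient φ x) =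
        ∫ x in E, inner ℝ (A x σ (u x σ) (V x σ)) (gradient φ x) := fun σ ↦ by
      rw [← integral_indicator hEm]
      refine integral_congr_ae (ae_of_all _ fun x ↦ ?_)
      by_cases hx : x ∈ E <;> simp [hx]
    simp only [c1, c2]
    linarith
  · have hw1 : ∀ᵐ τ ∂volume.restrict (Ioc t₁ t₂),
        HasWeakGradient Ω (fun x ↦ u x τ ^ mMinus m) (fun x ↦ V x τ) :=
      ae_mono (Measure.restrict_mono (fun τ hτ ↦ (hIcc (Ioc_subset_Icc_self hτ)).2) le_rfl)
        hV.weakGradient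
    filter_upwards [hw1] with τ hτ φ hφ hφs hφO
    have h3 := hτ.2.2 φ hφ hφs (hφO.trans (hOE.trans hEΩ))
    simp only [mMinus_of_one_le hm.le, Real.rpow_one] at h3
    have g0 : ∀ x, x ∉ Metric.ball y R → gradient φ x = 0 := fun x hx ↦
      gradient_eq_zero_of_notMem_tsupport fun h ↦ hx (hφO h)
    have f0 : ∀ x, x ∉ Metric.ball y R → φ x = 0 := fun x hx ↦
      image_eq_zero_of_notMem_tsupport fun h ↦ hx (hφO h)
    rw [setIntegral_eq_of_tsupport_subset (hOE.trans hEΩ) (fun x hx ↦ by simp [g0 x hx]),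
      setIntegral_eq_of_tsupport_subset (hOE.trans hEΩ) (fun x hx ↦ by simp [f0 x hx])] at h3
    refine Eq.trans (integral_congr_ae (ae_of_all _ fun x ↦ ?_)) (h3.trans (congrArg _
      (integral_congr_ae (ae_of_all _ fun x ↦ ?_))))
    · by_cases hx : x ∈ Metric.ball y R
      · simp [hOE hx]
      · simp [g0 x hx]
    · by_cases hx : x ∈ Metric.ball y R
      · simp [hOE hx]
      · simp [f0 x hx]
  · have h1 : ∀ᵐ z ∂(volume : Measure (Space N)).prod (volume.restrict (Ioc t₁ t₂)), z.1 ∈ E →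
        u z.1 z.2 ∈ Icc 0 μ ∧ ∀ v : ℝ, 0 ≤ v → ∀ ξ : Space N,
          ‖A z.1 z.2 v ξ‖ ≤ K₂ * v ^ ((m - 1) * (p - 1)) * ‖ξ‖ ^ (p - 1) ∧
          K₁ * v ^ ((m - 1) * (p - 1)) * ‖ξ‖ ^ p ≤ inner ℝ (A z.1 z.2 v ξ) ξ := by
      have h2 := hub.and hstr
      rw [Measure.volume_eq_prod, ← Measure.prod_restrict] at h2
      have h3 : (volume.restrict E).prod (volume.restrict (Ioc t₁ t₂)) =
          ((volume : Measure (Space N)).prod (volume.restrict (Ioc t₁ t₂))).restrict (E ×ˢ univ) := by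
        rw [← Measure.prod_restrict, Measure.restrict_univ]
      rw [h3, ae_restrict_iff' (hEm.prod MeasurableSet.univ)] at h2
      filter_upwards [h2] with z hz hzE using hz ⟨hzE, mem_univ _⟩
    filter_upwards [h1] with z hz hzE
    simp only [hzE, indicator_of_mem]
    exact ⟨(hz hzE).1, (hz hzE).2 _ (hz hzE).1.1 _⟩

end

/-! ### Pointwise Young inequalities for the flux. -/

/-- A comparison of `b` with `κ x` suffices, since sharp constants are irrelevant. -/
theorem rpow_mul_le_young {p x b κ : ℝ} (hp : 1 < p) (hx : 0 ≤ x) (hb : 0 ≤ b) (hκ : 0 < κ) :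
    x ^ (p - 1) * b ≤ κ * x ^ p + κ ^ (1 - p) * b ^ p := by
  have hp0 : 0 < p - 1 := by linarith
  have h1 : 0 ≤ κ * x ^ p := by positivity
  have h2 : 0 ≤ κ ^ (1 - p) * b ^ p := by positivity
  have split : ∀ t : ℝ, 0 ≤ t → t ^ p = t ^ (p - 1) * t := fun t ht ↦ by
    rw [← Real.rpow_add_one' ht (by linarith)]; congr 1; ring
  rcases le_total b (κ * x) with h | h
  · have : x ^ (p - 1) * b ≤ x ^ (p - 1) * (κ * x) := by gcongr
    rw [split x hx]
    nlinarith
  · have h3 : x ≤ b / κ := by rw [le_div_iff₀ hκ]; linarith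
    have h4 : x ^ (p - 1) * b ≤ (b / κ) ^ (p - 1) * b := by gcongr
    have h5 : (b / κ) ^ (p - 1) * b = κ ^ (1 - p) * b ^ p := by
      rw [Real.div_rpow hb hκ.le, split b hb, show 1 - p = -(p - 1) by ring, Real.rpow_neg hκ.le]
      ring
    linarith

theorem rpow_mul_rpow_le {a b x y δ : ℝ} (ha : 0 < a) (hb : 0 < b) (hab : a + b = 1) (hx : 0 ≤ x)
    (hy : 0 ≤ y) (hδ : 0 < δ) : y ^ a * x ^ b ≤ δ * x + δ ^ (-(b / a)) * y := by
  have split : ∀ t : ℝ, 0 ≤ t → t = t ^ a * t ^ b := fun t ht ↦ by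
    rw [← Real.rpow_add' ht (by rw [hab]; norm_num), hab, Real.rpow_one]
  have h1 : 0 ≤ δ * x := by positivity
  have h2 : 0 ≤ δ ^ (-(b / a)) * y := by positivity
  rcases le_total (y ^ a) (δ * x ^ a) with h | h
  · have : y ^ a * x ^ b ≤ δ * x ^ a * x ^ b := by gcongr
    have e := split x hx
    have : δ * x ^ a * x ^ b = δ * x := by rw [mul_assoc, ← e]
    linarith
  · have h3 : x ^ b ≤ δ ^ (-(b / a)) * y ^ b := by
      have h4 : (x ^ a) ^ (b / a) ≤ (δ⁻¹ * y ^ a) ^ (b / a) := by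
        gcongr
        rw [le_inv_mul_iff₀ hδ]; exact h
      rw [Real.mul_rpow (by positivity) (by positivity), ← Real.rpow_mul hx, ← Real.rpow_mul hy,
        mul_div_cancel₀ _ ha.ne', Real.inv_rpow hδ.le, ← Real.rpow_neg hδ.le] at h4
      exact h4
    have h5 : y ^ a * x ^ b ≤ y ^ a * (δ ^ (-(b / a)) * y ^ b) := by gcongr
    have e := split y hy
    have : y ^ a * (δ ^ (-(b / a)) * y ^ b) = δ ^ (-(b / a)) * y := by
      rw [mul_left_comm, ← e]
    linarith

/-- The truncation at `ν / 2` makes negative powers continuous on all of `ℝ`. With `c = μ + ν` it is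
inactive near every `v ≤ μ`, so the derivative there is the usual one, also at the endpoint `μ`. -/
theorem hasDerivAt_max_sub_rpow {c ν v γ : ℝ} (hν : 0 < ν) (hv : ν / 2 < c - v) :
    HasDerivAt (fun v ↦ (max (c - v) (ν / 2)) ^ γ) (-γ * (max (c - v) (ν / 2)) ^ (γ - 1)) v := by
  have h1 : HasDerivAt (fun v ↦ (c - v) ^ γ) (-1 * γ * (c - v) ^ (γ - 1)) v :=
    ((hasDerivAt_id v).const_sub c).rpow_const (Or.inl (by simp only [id]; linarith))
  rw [max_eq_left hv.le]
  have : (fun v ↦ (max (c - v) (ν / 2)) ^ γ) =ᶠ[𝓝 v] fun v ↦ (c - v) ^ γ := by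
    have : ∀ᶠ w in 𝓝 v, ν / 2 < c - w :=
      (continuous_const.sub continuous_id).continuousAt.eventually_const_lt hv
    filter_upwards [this] with w hw
    rw [max_eq_left hw.le]
  exact (h1.congr_of_eventuallyEq this).congr_deriv (by ring)

theorem continuous_max_sub_rpow {c ν γ : ℝ} (hν : 0 < ν) :
    Continuous (fun v : ℝ ↦ (max (c - v) (ν / 2)) ^ γ) := by
  refine Continuous.rpow_const (by fun_prop) fun v ↦ Or.inl ?_
  exact (lt_of_lt_of_le (by positivity) (le_max_right _ _)).ne'

/-- Young's inequality for the flux terms: `X` stands for the length of the gradient, `W` for the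
distance of the solution to its supremum and `z` for the value of the cutoff function. -/
theorem flux_young {p X W L z κ : ℝ} {k : ℕ} (hp : 1 < p) (hp2 : p ≤ 2) (hX : 0 ≤ X) (hW : 0 < W)
    (hL : 0 ≤ L) (hz0 : 0 ≤ z) (hz1 : z ≤ 1) (hκ : 0 < κ) :
    X ^ (p - 1) * z ^ (k + 1) * L ≤
      κ * (X ^ p * z ^ (k + 2) * W⁻¹) + κ ^ (1 - p) * (W ^ (p - 1) * z ^ k * L ^ p) := by
  rcases hz0.eq_or_lt with rfl | hz
  · simp only [ne_eq, Nat.add_eq_zero_iff, one_ne_zero, and_false, not_false_eq_true, zero_pow,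
      mul_zero, zero_mul, OfNat.ofNat_ne_zero, zero_add]
    positivity
  -- With `b = W L / z`, multiplication by `z^(k+2) / W` restores the left-hand side.
  · have h := rpow_mul_le_young hp hX (b := W * L / z) (by positivity) hκ
    have h2 := mul_le_mul_of_nonneg_right h (show 0 ≤ z ^ (k + 2) * W⁻¹ by positivity)
    have e1 : X ^ (p - 1) * (W * L / z) * (z ^ (k + 2) * W⁻¹) = X ^ (p - 1) * z ^ (k + 1) * L := by
      field_simp
      ring
    rw [e1] at h2
    refine h2.trans ?_
    rw [add_mul]
    gcongr ?_ + ?_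
    · apply le_of_eq; ring
    · rw [mul_assoc]
      refine mul_le_mul_of_nonneg_left ?_ (by positivity)
      rw [Real.div_rpow (by positivity) hz.le, Real.mul_rpow hW.le hL]
      have hWp : W ^ p = W ^ (p - 1) * W := by
        rw [← Real.rpow_add_one hW.ne']; congr 1; ring
      -- Since `0 < z ≤ 1` and `p ≤ 2`, the factor `z^(k+2-p)` is at most `z^k`.
      have hz2 : z ^ 2 ≤ z ^ p := by
        rw [← Real.rpow_natCast z 2]
        exact Real.rpow_le_rpow_of_exponent_ge hz hz1 (by simpa using hp2)
      rw [hWp]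
      have e3 : W ^ (p - 1) * W * L ^ p / z ^ p * (z ^ (k + 2) * W⁻¹) =
          W ^ (p - 1) * z ^ k * L ^ p * (z ^ 2 / z ^ p) := by
        field_simp
        ring
      rw [e3]
      refine mul_le_of_le_one_right (by positivity) ?_
      rw [div_le_one (by positivity)]
      exact hz2

/-- Multiplied by `W^(-α)`, the lower order term of `flux_young` carries `W^(p-1-α) = W^(p-2) W^β`.
As `p < 2`, the singular factor is at most `ν^(p-2)`, and coercivity converts `a X^p` into `j`. -/
theorem flux_bound_energy {p X W L z κ K₁ K₂ a M ν f d j α β n : ℝ} {k : ℕ} (hp : 1 < p) (hp2 : p < 2)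
    (hαβ : α + β = 1) (hX : 0 ≤ X)
    (hν : 0 < ν) (hW : ν ≤ W) (hL : 0 ≤ L) (hz0 : 0 ≤ z) (hz1 : z ≤ 1) (hκ : 0 < κ) (hK₁ : 0 < K₁)
    (hK₂ : 0 < K₂) (ha : 0 ≤ a) (haM : a ≤ M) (hn : 0 ≤ n) (hf : f ≤ K₂ * a * X ^ (p - 1))
    (hd0 : 0 ≤ d) (hd : d ≤ n * z ^ (k + 1) * L) (hj : K₁ * a * X ^ p ≤ j) :
    W ^ (-α) * (f * d) ≤ K₂ * n * (κ / K₁ * (z ^ (k + 2) * W ^ (-α - 1) * j) +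
      κ ^ (1 - p) * L ^ p * M * ν ^ (p - 2) * (z ^ k * W ^ β)) := by
  have hW0 : 0 < W := hν.trans_le hW
  have hM : 0 ≤ M := ha.trans haM
  have hfy := mul_le_mul_of_nonneg_left (flux_young (k := k) hp hp2.le hX hW0 hL hz0 hz1 hκ)
    (show 0 ≤ K₂ * n * a * W ^ (-α) by positivity)
  have h1 : W ^ (-α) * (f * d) ≤ W ^ (-α) * ((K₂ * a * X ^ (p - 1)) * (n * z ^ (k + 1) * L)) := by
    gcongr
  have eW1 : W ^ (-α) * W⁻¹ = W ^ (-α - 1) := by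
    rw [Real.rpow_sub_one hW0.ne', div_eq_mul_inv]
  have eW2 : W ^ (-α) * W ^ (p - 1) = W ^ (p - 2) * W ^ β := by
    rw [← Real.rpow_add hW0, ← Real.rpow_add hW0]; congr 1; linarith
  have hWν : W ^ (p - 2) ≤ ν ^ (p - 2) := Real.rpow_le_rpow_of_nonpos hν hW (by linarith)
  have t1 : κ * (a * X ^ p * z ^ (k + 2) * W ^ (-α - 1)) ≤
      κ / K₁ * (z ^ (k + 2) * W ^ (-α - 1) * j) := by
    rw [div_mul_eq_mul_div, le_div_iff₀ hK₁]
    have := mul_le_mul_of_nonneg_left hj (show 0 ≤ κ * (z ^ (k + 2) * W ^ (-α - 1)) by positivity)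
    nlinarith
  have t2 : κ ^ (1 - p) * (a * (W ^ (p - 2) * W ^ β) * z ^ k * L ^ p) ≤
      κ ^ (1 - p) * L ^ p * M * ν ^ (p - 2) * (z ^ k * W ^ β) := by
    calc _ ≤ κ ^ (1 - p) * (M * (ν ^ (p - 2) * W ^ β) * z ^ k * L ^ p) := by gcongr
      _ = _ := by ring
  refine h1.trans (le_trans (le_of_eq (by ring)) (hfy.trans ?_))
  calc _ = K₂ * n * (κ * (a * X ^ p * z ^ (k + 2) * (W ^ (-α) * W⁻¹)) +
        κ ^ (1 - p) * (a * (W ^ (-α) * W ^ (p - 1)) * z ^ k * L ^ p)) := by ring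
    _ ≤ _ := by
        rw [eW1, eW2]
        gcongr

/-- Taking `κ = ε W^(-α)` in `flux_young` produces the energy weight `W^(-α-1)`; the other term
carries `W^((α+1)(p-1)) = W^β`. -/
theorem flux_bound_linear {p X W L z ε K₁ K₂ a M f d j α β n : ℝ} {k : ℕ} (hp : 1 < p) (hp2 : p < 2)
    (hα : (α + 1) * (p - 1) = β) (hX : 0 ≤ X)
    (hW0 : 0 < W) (hL : 0 ≤ L) (hz0 : 0 ≤ z) (hz1 : z ≤ 1) (hε : 0 < ε) (hK₁ : 0 < K₁)
    (hK₂ : 0 < K₂) (ha : 0 ≤ a) (haM : a ≤ M) (hn : 0 ≤ n) (hf : f ≤ K₂ * a * X ^ (p - 1))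
    (hd0 : 0 ≤ d) (hd : d ≤ n * z ^ (k + 1) * L) (hj : K₁ * a * X ^ p ≤ j) :
    f * d ≤ K₂ * n * (ε / K₁ * (z ^ (k + 2) * W ^ (-α - 1) * j) +
      ε ^ (1 - p) * L ^ p * M * (z ^ k * W ^ β)) := by
  have hfy := mul_le_mul_of_nonneg_left (flux_young (k := k) (κ := ε * W ^ (-α)) hp hp2.le hX hW0
    hL hz0 hz1 (by positivity)) (show 0 ≤ K₂ * n * a by positivity)
  have h1 : f * d ≤ (K₂ * a * X ^ (p - 1)) * (n * z ^ (k + 1) * L) := by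
    gcongr
  have eW1 : W ^ (-α) * W⁻¹ = W ^ (-α - 1) := by
    rw [Real.rpow_sub_one hW0.ne', div_eq_mul_inv]
  have eW2 : (ε * W ^ (-α)) ^ (1 - p) * W ^ (p - 1) = ε ^ (1 - p) * W ^ β := by
    rw [Real.mul_rpow hε.le (by positivity), ← Real.rpow_mul hW0.le, mul_assoc,
      ← Real.rpow_add hW0]
    congr 2; rw [← hα]; ring
  have t1 : ε * (a * X ^ p * z ^ (k + 2) * W ^ (-α - 1)) ≤
      ε / K₁ * (z ^ (k + 2) * W ^ (-α - 1) * j) := by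
    rw [div_mul_eq_mul_div, le_div_iff₀ hK₁]
    have := mul_le_mul_of_nonneg_left hj (show 0 ≤ ε * (z ^ (k + 2) * W ^ (-α - 1)) by positivity)
    nlinarith
  have t2 : a * (ε ^ (1 - p) * W ^ β) * z ^ k * L ^ p ≤
      ε ^ (1 - p) * L ^ p * M * (z ^ k * W ^ β) := by
    calc _ ≤ M * (ε ^ (1 - p) * W ^ β) * z ^ k * L ^ p := by gcongr
      _ = _ := by ring
  refine h1.trans (le_trans (le_of_eq (by ring)) (hfy.trans ?_))
  calc _ = K₂ * n * (ε * (a * X ^ p * z ^ (k + 2) * (W ^ (-α) * W⁻¹)) +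
        a * ((ε * W ^ (-α)) ^ (1 - p) * W ^ (p - 1)) * z ^ k * L ^ p) := by ring
    _ ≤ _ := by
        rw [eW1, eW2]
        gcongr

/-! ### Time variation of weighted integrals. -/

section

variable {N : ℕ} {O : Set (Space N)} {t₁ t₂ μ p q : ℝ} {U : Space N → ℝ → ℝ} {F V : Space N → ℝ → Space N}

theorem integrable_mul_comp_of_mem_Icc {f : Space N → ℝ} (hf : AEStronglyMeasurable f)
    (hb : ∀ᵐ x, x ∈ O → f x ∈ Icc 0 μ) {η : Space N → ℝ} (hη : Continuous η)
    (hηs : HasCompactSupport η) (hηO : tsupport η ⊆ O) {c : ℝ → ℝ} (hc : Continuous c) :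
    Integrable (fun x ↦ η x * c (f x)) := by
  obtain ⟨C, hC⟩ := isCompact_Icc.exists_bound_of_continuousOn (hc.continuousOn (s := Icc 0 μ))
  have hηi : Integrable η := hη.integrable_of_hasCompactSupport hηs
  refine (hηi.norm.mul_const C).mono' (hηi.1.mul (hc.comp_aestronglyMeasurable hf)) ?_
  filter_upwards [hb] with x hx
  by_cases h : x ∈ tsupport η
  · rw [norm_mul]
    gcongr
    exact hC _ (hx (hηO h))
  · simp [image_eq_zero_of_notMem_tsupport h]

theorem integrable_mul_comp_mul_of_mem_Icc {f h : Space N × ℝ → ℝ} {κ : Measure (Space N × ℝ)}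
    (hf : AEStronglyMeasurable f κ) (hh : Integrable h κ)
    (hb : ∀ᵐ z ∂κ, z.1 ∈ O → f z ∈ Icc 0 μ) {η : Space N → ℝ} (hη : Continuous η)
    (hηs : HasCompactSupport η) (hηO : tsupport η ⊆ O) {c : ℝ → ℝ} (hc : Continuous c) :
    Integrable (fun z ↦ η z.1 * c (f z) * h z) κ := by
  obtain ⟨C, hC⟩ := isCompact_Icc.exists_bound_of_continuousOn (hc.continuousOn (s := Icc 0 μ))
  obtain ⟨B, hB⟩ := hηs.exists_bound_of_continuous hη
  have hB0 : 0 ≤ B := (norm_nonneg _).trans (hB 0)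
  refine hh.bdd_mul (c := max 0 (B * C)) ((hη.comp continuous_fst).aestronglyMeasurable.mul
    (hc.comp_aestronglyMeasurable hf)) ?_
  filter_upwards [hb] with x hx
  by_cases h : x.1 ∈ tsupport η
  · refine le_max_of_le_right ?_
    rw [norm_mul]
    gcongr
    · exact hB _
    · exact hC _ (hx (hηO h))
  · simp [image_eq_zero_of_notMem_tsupport h]

theorem gradient_pow {ζ : Space N → ℝ} (hζ : ContDiff ℝ 1 ζ) (n : ℕ) (x : Space N) :
    gradient (fun x ↦ ζ x ^ (n + 1)) x = (((n + 1 : ℕ) : ℝ) * ζ x ^ n) • gradient ζ x := by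
  have h1 : HasFDerivAt ζ (fderiv ℝ ζ x) x := (hζ.differentiable one_ne_zero x).hasFDerivAt
  have h2 := (h1.pow (n + 1)).fderiv
  rw [gradient, h2, gradient, Nat.add_sub_cancel]
  simp

theorem tsupport_pow_subset (ζ : Space N → ℝ) {n : ℕ} (hn : n ≠ 0) :
    tsupport (fun x ↦ ζ x ^ n) ⊆ tsupport ζ :=
  closure_mono fun x hx h ↦ hx (by simp [h, hn])

theorem IsDivergenceSolution.integrable_inner (h : IsDivergenceSolution O t₁ t₂ μ p q U F V)
    (hpq : p.HolderConjugate q) :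
    Integrable (fun z : Space N × ℝ ↦ inner ℝ (F z.1 z.2) (V z.1 z.2))
      (volume.prod (volume.restrict (Ioc t₁ t₂))) := by
  have : ENNReal.HolderTriple (ENNReal.ofReal q) (ENNReal.ofReal p) 1 := hpq.symm.ennrealOfReal
  exact memLp_one_iff_integrable.1 ⟨h.memLp_flux.1.inner h.memLp_grad.1,
      (eLpNorm_inner_le (p := ENNReal.ofReal q) (q := ENNReal.ofReal p) h.memLp_flux.1
        h.memLp_grad.1).trans_lt (ENNReal.mul_lt_top h.memLp_flux.2 h.memLp_grad.2)⟩

theorem integral_prod_le_of_slice_le {f : Space N × ℝ → ℝ} (h12 : t₁ ≤ t₂)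
    (hf : Integrable f ((volume : Measure (Space N)).prod (volume.restrict (Ioc t₁ t₂)))) {G : ℝ}
    (hG : ∀ τ ∈ Icc t₁ t₂, ∫ x, f (x, τ) ≤ G) :
    ∫ z, f z ∂((volume : Measure (Space N)).prod (volume.restrict (Ioc t₁ t₂))) ≤
      (t₂ - t₁) * G := by
  rw [integral_prod_symm _ hf]
  calc _ ≤ ∫ τ in Ioc t₁ t₂, G := by
        refine integral_mono_ae hf.integral_prod_right (integrable_const G) ?_
        filter_upwards [ae_restrict_mem measurableSet_Ioc] with τ hτ
        exact hG τ (Ioc_subset_Icc_self hτ)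
    _ = _ := by simp [h12]

/-- The variation in time of a weighted integral of a solution of the doubly nonlinear equation. -/
theorem exists_abs_integral_sub_le {K₁ K₂ Λ : ℝ} (hp : 1 < p) (hp2 : p < 2) (hK₁ : 0 < K₁)
    (hK₂ : 0 < K₂) (hΛ : 0 ≤ Λ) {k : ℕ} (hk : k ≠ 0) :
    ∃ C : ℝ, 0 < C ∧ ∀ (N : ℕ) (O : Set (Space N)) (t₁ t₂ μ : ℝ) (U : Space N → ℝ → ℝ)
      (F V : Space N → ℝ → Space N), IsDivergenceSolution O t₁ t₂ μ p (p / (p - 1)) U F V →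
      IsOpen O → ∀ e : ℝ, 0 ≤ e →
      (∀ᵐ z ∂(volume : Measure (Space N)).prod (volume.restrict (Ioc t₁ t₂)), z.1 ∈ O →
        U z.1 z.2 ∈ Icc 0 μ ∧ ‖F z.1 z.2‖ ≤ K₂ * U z.1 z.2 ^ e * ‖V z.1 z.2‖ ^ (p - 1) ∧
        K₁ * U z.1 z.2 ^ e * ‖V z.1 z.2‖ ^ p ≤ inner ℝ (F z.1 z.2) (V z.1 z.2)) →
      ∀ ζ : Space N → ℝ, ContDiff ℝ 1 ζ → HasCompactSupport ζ → tsupport ζ ⊆ O →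
      (∀ x, 0 ≤ ζ x) → (∀ x, ζ x ≤ 1) → ∀ L ν G : ℝ, (∀ x, ‖gradient ζ x‖ ≤ L) → 0 < ν →
      L ^ p * μ ^ e * (t₂ - t₁) ≤ Λ * ν ^ (2 - p) →
      (∀ τ ∈ Icc t₁ t₂,
        ∫ x, ζ x ^ k * (max (μ + ν - U x τ) (ν / 2)) ^ (2 * (p - 1) / p) ≤ G) →
      |(∫ x, ζ x ^ (k + 2) * U x t₂) - ∫ x, ζ x ^ (k + 2) * U x t₁| ≤
        C * ν ^ ((2 - p) / p) * G := by
  -- The requirements `α + β = 1` (energy test) and `(α + 1)(p - 1) = β` (linear test) determine `α`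
  -- and `β`.
  set α : ℝ := (2 - p) / p with hα
  set β : ℝ := 2 * (p - 1) / p with hβ
  have hp0 : 0 < p := by linarith
  have hα0 : 0 < α := div_pos (by linarith) hp0
  have hβ0 : 0 < β := div_pos (by linarith) hp0
  have hαβ : α + β = 1 := by rw [hα, hβ]; field_simp; ring
  have hαβ' : (α + 1) * (p - 1) = β := by rw [hα, hβ]; field_simp; ring
  have hα1 : α * (1 - p) + (2 - p) = α := by rw [hα]; field_simp; ring
  set n : ℝ := ((k + 2 : ℕ) : ℝ) with hn
  have hn0 : 0 < n := by rw [hn]; positivity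
  -- Makes `K₂ n κ / K₁ = α / 2`, so that half of the energy term is absorbed.
  set κ : ℝ := α * K₁ / (2 * K₂ * n) with hκ
  have hκ0 : 0 < κ := by positivity
  set CJ : ℝ := 2 / α * (1 / β + K₂ * n * (κ ^ (1 - p) * Λ)) with hCJ
  refine ⟨K₂ * n * (CJ / K₁ + Λ), by positivity, ?_⟩
  intro N O t₁ t₂ μ U F V h hO e he hflux ζ hζ hζs hζO h0 h1 L ν G hL hν hLΛ hG
  have hL0 : 0 ≤ L := (norm_nonneg _).trans (hL 0)
  have hpq : p.HolderConjugate (p / (p - 1)) := Real.HolderConjugate.conjExponent hp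
  set m : Measure (Space N × ℝ) := (volume : Measure (Space N)).prod (volume.restrict (Ioc t₁ t₂))
    with hm
  have hθ : 0 ≤ t₂ - t₁ := by linarith [h.le]
  set W : ℝ → ℝ := fun v ↦ max (μ + ν - v) (ν / 2) with hW
  have hW0 : ∀ v, 0 < W v := fun v ↦ lt_of_lt_of_le (by positivity) (le_max_right _ _)
  have hWc : ∀ γ : ℝ, Continuous fun v ↦ W v ^ γ := fun γ ↦ continuous_max_sub_rpow hν
  have hWd : ∀ γ : ℝ, ∀ v ∈ Icc 0 μ, HasDerivAt (fun v ↦ W v ^ γ) (-γ * W v ^ (γ - 1)) v :=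
    fun γ v hv ↦ hasDerivAt_max_sub_rpow hν (by linarith [hv.2])
  set η : Space N → ℝ := fun x ↦ ζ x ^ (k + 2) with hη
  have hη1 : ContDiff ℝ 1 η := hζ.pow _
  have hts : ∀ j : ℕ, j ≠ 0 → tsupport (fun x ↦ ζ x ^ j) ⊆ tsupport ζ := fun j hj ↦
    tsupport_pow_subset ζ hj
  have hcs : ∀ j : ℕ, j ≠ 0 → HasCompactSupport (fun x ↦ ζ x ^ j) := fun j hj ↦
    hζs.isCompact.of_isClosed_subset (isClosed_tsupport _) (hts j hj)
  have hcj : ∀ j : ℕ, Continuous (fun x ↦ ζ x ^ j) := fun j ↦ hζ.continuous.pow j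
  have hηs : HasCompactSupport η := hcs _ (by omega)
  have hηζ : tsupport η ⊆ tsupport ζ := hts _ (by omega)
  have hηg : ∀ x, ‖gradient η x‖ ≤ n * ζ x ^ (k + 1) * L := fun x ↦ by
    rw [hη, gradient_pow hζ (k + 1), norm_smul, Real.norm_of_nonneg
      (mul_nonneg (by positivity) (pow_nonneg (h0 x) _))]
    exact mul_le_mul_of_nonneg_left (hL x) (mul_nonneg (by positivity) (pow_nonneg (h0 x) _))
  have hUb : ∀ᵐ z ∂m, z.1 ∈ O → U z.1 z.2 ∈ Icc 0 μ := by
    filter_upwards [hflux] with z hz hzO using (hz hzO).1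
  have hi := h.integrable_inner hpq
  have ij : Integrable (fun z : Space N × ℝ ↦ η z.1 * W (U z.1 z.2) ^ (-α - 1) *
      inner ℝ (F z.1 z.2) (V z.1 z.2)) m :=
    integrable_mul_comp_mul_of_mem_Icc (c := fun v ↦ W v ^ (-α - 1)) h.integrable.1 hi hUb
      hη1.continuous hηs (hηζ.trans hζO) (hWc _)
  have hone : Integrable (fun z : Space N × ℝ ↦ (tsupport ζ).indicator (1 : Space N → ℝ) z.1) m := by
    have : Integrable ((tsupport ζ).indicator (1 : Space N → ℝ)) :=
      (integrable_indicator_iff (isClosed_tsupport ζ).measurableSet).2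
        (integrableOn_const (hs := hζs.isCompact.measure_lt_top.ne))
    exact this.comp_fst _
  have iS : Integrable (fun z : Space N × ℝ ↦ ζ z.1 ^ k * W (U z.1 z.2) ^ β) m := by
    have := integrable_mul_comp_mul_of_mem_Icc (c := fun v ↦ W v ^ β) h.integrable.1 hone hUb
      (hcj k) (hcs k hk) ((hts k hk).trans hζO) (hWc _)
    refine this.congr (ae_of_all _ fun z ↦ ?_)
    by_cases hz : z.1 ∈ tsupport ζ
    · simp [hz]
    · simp [hz, image_eq_zero_of_notMem_tsupport hz, hk]
  set J : ℝ := ∫ z : Space N × ℝ, η z.1 * W (U z.1 z.2) ^ (-α - 1) *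
      inner ℝ (F z.1 z.2) (V z.1 z.2) ∂m with hJ
  set S : ℝ := ∫ z : Space N × ℝ, ζ z.1 ^ k * W (U z.1 z.2) ^ β ∂m with hS
  have hSG : S ≤ (t₂ - t₁) * G := integral_prod_le_of_slice_le h.le iS hG
  have hslice : ∀ j : ℕ, j ≠ 0 → ∀ τ ∈ Icc t₁ t₂, Integrable (fun x ↦ ζ x ^ j * W (U x τ) ^ β) :=
    fun j hj τ hτ ↦ integrable_mul_comp_of_mem_Icc (c := fun v ↦ W v ^ β)
      (h.integrable_slice τ hτ).1 (h.bound τ hτ) (hcj j) (hcs j hj) ((hts j hj).trans hζO) (hWc _)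
  have hnn : ∀ j : ℕ, ∀ τ, 0 ≤ ∫ x, ζ x ^ j * W (U x τ) ^ β := fun j τ ↦
    integral_nonneg fun x ↦ mul_nonneg (pow_nonneg (h0 x) _) (Real.rpow_nonneg (hW0 _).le _)
  have hG0 : 0 ≤ G := (hnn k t₁).trans (hG t₁ (left_mem_Icc.2 h.le))
  have hηG : ∀ τ ∈ Icc t₁ t₂, ∫ x, η x * W (U x τ) ^ β ≤ G := fun τ hτ ↦ by
    refine le_trans (integral_mono (hslice (k + 2) (by omega) τ hτ) (hslice k hk τ hτ) fun x ↦ ?_)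
      (hG τ hτ)
    exact mul_le_mul_of_nonneg_right (pow_le_pow_of_le_one (h0 x) (h1 x) (by omega))
      (Real.rpow_nonneg (hW0 _).le _)
  -- This is where the smallness condition enters. An empty support is treated apart because only a
  -- nonempty one forces `μ ≥ 0`, needed for `μ^e ≥ 0`.
  have hLS : ∀ c : ℝ, 0 ≤ c → c * L ^ p * μ ^ e * S ≤ c * (Λ * ν ^ (2 - p)) * G := fun c hc ↦ by
    rcases (tsupport ζ).eq_empty_or_nonempty with hemp | ⟨x₀, hx₀⟩
    · have hz : S = 0 := by
        rw [hS]
        refine integral_eq_zero_of_ae (ae_of_all _ fun z ↦ ?_)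
        have : ζ z.1 = 0 := image_eq_zero_of_notMem_tsupport (by rw [hemp]; exact notMem_empty _)
        simp [this, hk]
      rw [hz, mul_zero]
      positivity
    · have hμ : 0 ≤ μ := by
        have hae := h.bound t₁ (left_mem_Icc.2 h.le)
        by_contra hneg
        have : volume O = 0 := by
          refine measure_mono_null (fun x hx ↦ ?_) hae
          intro hx'
          exact hneg ((hx' hx).1.trans (hx' hx).2)
        exact (hO.measure_pos volume ⟨x₀, hζO hx₀⟩).ne' this
      calc c * L ^ p * μ ^ e * S ≤ c * L ^ p * μ ^ e * ((t₂ - t₁) * G) := by gcongr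
        _ = c * (L ^ p * μ ^ e * (t₂ - t₁)) * G := by ring
        _ ≤ _ := by gcongr
  have energy := h.energy_identity hO hpq hη1 hηs (hηζ.trans hζO)
    (Φ := fun v ↦ -(1 / β) * W v ^ β) (g := fun v ↦ W v ^ (-α)) (g' := fun v ↦ α * W v ^ (-α - 1))
    (fun v hv ↦ ((hWd β v hv).const_mul (-(1 / β))).congr_deriv (by
      rw [show β - 1 = -α by linarith]; field_simp))
    (fun v hv ↦ (hWd (-α) v hv).congr_deriv (by rw [neg_neg])) (continuous_const.mul (hWc _)) (hWc _)
    (continuous_const.mul (hWc _))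
  have eJ : ∫ z : Space N × ℝ, η z.1 * (α * W (U z.1 z.2) ^ (-α - 1)) *
      inner ℝ (F z.1 z.2) (V z.1 z.2) ∂m = α * J := by
    rw [hJ, ← integral_const_mul]
    refine integral_congr_ae (ae_of_all _ fun z ↦ ?_)
    simp only; ring
  have eΦ : ∀ τ, ∫ x, η x * (-(1 / β) * W (U x τ) ^ β) = -(1 / β) * ∫ x, η x * W (U x τ) ^ β :=
    fun τ ↦ by
      rw [← integral_const_mul]
      refine integral_congr_ae (ae_of_all _ fun z ↦ ?_)
      simp only; ring
  simp only [eΦ] at energy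
  rw [← hm, eJ] at energy
  set E₂ : ℝ := ∫ z : Space N × ℝ, (tsupport η).indicator (1 : Space N → ℝ) z.1 * W (U z.1 z.2) ^ (-α) *
          inner ℝ (F z.1 z.2) (gradient η z.1) ∂m with hE₂
  have hE₂b : |E₂| ≤ α / 2 * J + K₂ * n * (κ ^ (1 - p) * L ^ p * μ ^ e * ν ^ (p - 2)) * S := by
    have hb : |E₂| ≤ ∫ z : Space N × ℝ, K₂ * n * (κ / K₁ * (η z.1 * W (U z.1 z.2) ^ (-α - 1) *
          inner ℝ (F z.1 z.2) (V z.1 z.2)) +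
        κ ^ (1 - p) * L ^ p * μ ^ e * ν ^ (p - 2) * (ζ z.1 ^ k * W (U z.1 z.2) ^ β)) ∂m := by
      rw [← Real.norm_eq_abs]
      refine norm_integral_le_of_norm_le (((ij.const_mul _).add (iS.const_mul _)).const_mul _) ?_
      filter_upwards [hflux] with z hz
      by_cases hx : z.1 ∈ tsupport ζ
      · obtain ⟨hz1, hz2, hz3⟩ := hz (hζO hx)
        have hWν : ν ≤ W (U z.1 z.2) := le_max_of_le_left (by linarith [hz1.2])
        refine le_trans ?_ (flux_bound_energy (k := k) hp hp2 hαβ (norm_nonneg (V z.1 z.2)) hν hWν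
          hL0 (h0 z.1) (h1 z.1) hκ0 hK₁ hK₂ (Real.rpow_nonneg hz1.1 e)
          (Real.rpow_le_rpow hz1.1 hz1.2 he) hn0.le hz2 (norm_nonneg _) (hηg z.1) hz3)
        rw [norm_mul, norm_mul, Real.norm_of_nonneg (Real.rpow_nonneg (hW0 _).le _), mul_assoc]
        refine (mul_le_of_le_one_left (by positivity) ?_).trans ?_
        · by_cases hy : z.1 ∈ tsupport η <;> simp [hy]
        · gcongr
          exact norm_inner_le_norm _ _
      · have hy : z.1 ∉ tsupport η := fun hy ↦ hx (hηζ hy)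
        simp [hy, image_eq_zero_of_notMem_tsupport hy, image_eq_zero_of_notMem_tsupport hx, hk]
    refine hb.trans (le_of_eq ?_)
    rw [integral_const_mul, integral_add (ij.const_mul _) (iS.const_mul _), integral_const_mul,
      integral_const_mul]
    have : K₂ * n * (κ / K₁) = α / 2 := by rw [hκ]; field_simp
    rw [mul_add, ← mul_assoc, this]
    ring
  have hS1 : K₂ * n * (κ ^ (1 - p) * L ^ p * μ ^ e * ν ^ (p - 2)) * S ≤
      K₂ * n * (κ ^ (1 - p) * Λ) * G := by
    have := hLS (K₂ * n * κ ^ (1 - p) * ν ^ (p - 2)) (by positivity)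
    have e1 : ν ^ (p - 2) * ν ^ (2 - p) = 1 := by
      rw [← Real.rpow_add hν]; simp
    calc _ = K₂ * n * κ ^ (1 - p) * ν ^ (p - 2) * L ^ p * μ ^ e * S := by ring
      _ ≤ _ := this
      _ = K₂ * n * (κ ^ (1 - p) * Λ) * (ν ^ (p - 2) * ν ^ (2 - p)) * G := by ring
      _ = _ := by rw [e1, mul_one]
  have hJb : J ≤ CJ * G := by
    have a1 := hηG t₂ (right_mem_Icc.2 h.le)
    have a2 := hnn (k + 2) t₁
    have a3 : 0 < 1 / β := by positivity
    -- The integral of `η W^β` at `t₁` enters with a favourable sign and is dropped.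
    have a4 : α * J + E₂ ≤ 1 / β * G := by
      have := mul_le_mul_of_nonneg_left a1 a3.le
      have := mul_nonneg a3.le a2
      simp only [hη] at *
      linarith
    have a5 := neg_abs_le E₂
    have a6 : α / 2 * J ≤ (1 / β + K₂ * n * (κ ^ (1 - p) * Λ)) * G := by linarith
    rw [hCJ]
    calc J = 2 / α * (α / 2 * J) := by field_simp
      _ ≤ 2 / α * ((1 / β + K₂ * n * (κ ^ (1 - p) * Λ)) * G) := by gcongr
      _ = _ := by ring
  -- The same identity with `Φ v = v`: only the flux against `∇η` remains, and the bound on `J`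
  -- controls it.
  have linear := h.energy_identity hO hpq hη1 hηs (hηζ.trans hζO)
    (Φ := fun v ↦ v) (g := fun _ ↦ 1) (g' := fun _ ↦ 0)
    (fun v _ ↦ hasDerivAt_id v) (fun v _ ↦ hasDerivAt_const v 1) continuous_id continuous_const
    continuous_const
  simp only [mul_zero, zero_mul, integral_zero, zero_add, mul_one] at linear
  rw [← hm] at linear
  rw [linear, abs_neg]
  have hνα : 0 < ν ^ α := Real.rpow_pos_of_pos hν _
  have hb : |∫ z : Space N × ℝ, (tsupport η).indicator (1 : Space N → ℝ) z.1 *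
      inner ℝ (F z.1 z.2) (gradient η z.1) ∂m| ≤
      ∫ z : Space N × ℝ, K₂ * n * (ν ^ α / K₁ * (η z.1 * W (U z.1 z.2) ^ (-α - 1) *
          inner ℝ (F z.1 z.2) (V z.1 z.2)) +
        (ν ^ α) ^ (1 - p) * L ^ p * μ ^ e * (ζ z.1 ^ k * W (U z.1 z.2) ^ β)) ∂m := by
    rw [← Real.norm_eq_abs]
    refine norm_integral_le_of_norm_le (((ij.const_mul _).add (iS.const_mul _)).const_mul _) ?_
    filter_upwards [hflux] with z hz
    by_cases hx : z.1 ∈ tsupport ζ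
    · obtain ⟨hz1, hz2, hz3⟩ := hz (hζO hx)
      refine le_trans ?_ (flux_bound_linear (k := k) hp hp2 hαβ' (norm_nonneg (V z.1 z.2))
        (hW0 (U z.1 z.2)) hL0 (h0 z.1) (h1 z.1) hνα hK₁ hK₂ (Real.rpow_nonneg hz1.1 e)
        (Real.rpow_le_rpow hz1.1 hz1.2 he) hn0.le hz2 (norm_nonneg _) (hηg z.1) hz3)
      rw [norm_mul]
      refine (mul_le_of_le_one_left (by positivity) ?_).trans (norm_inner_le_norm _ _)
      by_cases hy : z.1 ∈ tsupport η <;> simp [hy]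
    · have hy : z.1 ∉ tsupport η := fun hy ↦ hx (hηζ hy)
      simp [hy, image_eq_zero_of_notMem_tsupport hy, image_eq_zero_of_notMem_tsupport hx, hk]
  refine hb.trans ?_
  rw [integral_const_mul, integral_add (ij.const_mul _) (iS.const_mul _), integral_const_mul,
    integral_const_mul, ← hJ, ← hS]
  -- With `ε = ν^α` both terms scale like `ν^α`, because `α(1-p) + (2-p) = α`.
  have hS2 : (ν ^ α) ^ (1 - p) * L ^ p * μ ^ e * S ≤ Λ * ν ^ α * G := by
    have e1 : (ν ^ α) ^ (1 - p) * ν ^ (2 - p) = ν ^ α := by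
      rw [← Real.rpow_mul hν.le, ← Real.rpow_add hν, hα1]
    calc _ ≤ _ := hLS _ (by positivity)
      _ = Λ * ((ν ^ α) ^ (1 - p) * ν ^ (2 - p)) * G := by ring
      _ = _ := by rw [e1]
  calc K₂ * n * (ν ^ α / K₁ * J + (ν ^ α) ^ (1 - p) * L ^ p * μ ^ e * S)
      ≤ K₂ * n * (ν ^ α / K₁ * (CJ * G) + Λ * ν ^ α * G) := by gcongr
    _ = K₂ * n * (CJ / K₁ + Λ) * ν ^ α * G := by ring

end

/-! ### Cutoffs, slices on balls and interpolation. -/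

section

variable {N : ℕ} {Ω : Set (Space N)} {T m p : ℝ} {u : Space N → ℝ → ℝ} {V : Space N → ℝ → Space N}

/-- Rescaling one fixed bump makes `c` depend only on `N`. -/
theorem exists_cutoff (N : ℕ) : ∃ c : ℝ, 0 < c ∧ ∀ (y : Space N) (r : ℝ), 0 < r →
    ∃ ζ : Space N → ℝ, ContDiff ℝ 1 ζ ∧ tsupport ζ ⊆ Metric.closedBall y (3 / 2 * r) ∧
      (∀ x, 0 ≤ ζ x) ∧ (∀ x, ζ x ≤ 1) ∧ (∀ x ∈ Metric.ball y r, ζ x = 1) ∧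
      ∀ x, ‖gradient ζ x‖ ≤ c / r := by
  let f : ContDiffBump (0 : Space N) := ⟨1, 3 / 2, by norm_num, by norm_num⟩
  have hf : ContDiff ℝ 1 f := f.contDiff
  obtain ⟨C, hC0, hC⟩ := exists_norm_gradient_le hf f.hasCompactSupport
  refine ⟨C + 1, by linarith, fun y r hr ↦ ⟨fun x ↦ f (r⁻¹ • (x - y)), ?_, ?_, fun x ↦ f.nonneg,
    fun x ↦ f.le_one, fun x hx ↦ ?_, fun x ↦ ?_⟩⟩
  · exact hf.comp (by fun_prop)
  · refine closure_minimal (fun x hx ↦ ?_) Metric.isClosed_closedBall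
    have h1 : r⁻¹ • (x - y) ∈ Function.support f := hx
    rw [f.support_eq, mem_ball_zero_iff, norm_smul, Real.norm_of_nonneg (by positivity),
      inv_mul_lt_iff₀ hr] at h1
    rw [mem_closedBall_iff_norm]
    have h2 : f.rOut = 3 / 2 := rfl
    rw [h2] at h1
    linarith
  · refine f.one_of_mem_closedBall ?_
    rw [mem_closedBall_zero_iff, norm_smul, Real.norm_of_nonneg (by positivity),
      inv_mul_le_iff₀ hr]
    have h2 : f.rIn = 1 := rfl
    rw [h2, mul_one]
    exact (mem_ball_iff_norm.1 hx).le
  · have h1 : HasFDerivAt f (fderiv ℝ f (r⁻¹ • (x - y))) (r⁻¹ • (x - y)) :=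
      (hf.differentiable one_ne_zero _).hasFDerivAt
    have h2 := (h1.comp x (((hasFDerivAt_id x).sub_const y).const_smul r⁻¹)).fderiv
    have h3 : fderiv ℝ (fun x ↦ f (r⁻¹ • (x - y))) x =
        (fderiv ℝ f (r⁻¹ • (x - y))).comp (r⁻¹ • ContinuousLinearMap.id ℝ (Space N)) := h2
    rw [norm_gradient, h3, ContinuousLinearMap.comp_smul, ContinuousLinearMap.comp_id, norm_smul,
      Real.norm_of_nonneg (by positivity), ← norm_gradient, div_eq_inv_mul]
    have := hC (r⁻¹ • (x - y))
    gcongr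
    linarith

theorem ball_eq_iUnion_closedBall (y : Space N) (r : ℝ) :
    Metric.ball y r = ⋃ n : ℕ, Metric.closedBall y (r - 1 / (n + 1)) := by
  ext x
  simp only [Metric.mem_ball, mem_iUnion, Metric.mem_closedBall]
  constructor
  · intro h
    obtain ⟨n, hn⟩ := exists_nat_one_div_lt (sub_pos.2 h)
    exact ⟨n, by linarith⟩
  · rintro ⟨n, hn⟩
    have : 0 < 1 / ((n : ℝ) + 1) := by positivity
    linarith

/-- The open ball need not be relatively compact in `Ω`, so it is exhausted by closed balls. -/
theorem IsRegular.ball_mem_Icc (h : IsRegular Ω T m p u V) (hm : 1 ≤ m) {y : Space N} {r s t μ : ℝ}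
    (hst : s < t) (hBs : Metric.ball y r ×ˢ Ioo s t ⊆ spaceTime Ω T)
    (hμ : ∀ᵐ z ∂volume.restrict (Metric.ball y r ×ˢ Ioo s t), u z.1 z.2 ≤ μ)
    {τ : ℝ} (hτ : τ ∈ Icc s t ∩ Ioo 0 T) :
    (∀ᵐ x ∂volume.restrict (Metric.ball y r), u x τ ∈ Icc 0 μ) ∧
      IntegrableOn (fun x ↦ μ - u x τ) (Metric.ball y r) := by
  have hBΩ : Metric.ball y r ⊆ Ω := fun x hx ↦ by
    obtain ⟨σ, hσ⟩ := nonempty_Ioo.2 hst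
    exact (hBs (show (x, σ) ∈ _ ×ˢ _ from ⟨hx, hσ⟩)).1
  have hsub : ∀ n : ℕ, Metric.closedBall y (r - 1 / (n + 1)) ⊆ Metric.ball y r := fun n ↦ by
    conv_rhs => rw [ball_eq_iUnion_closedBall]
    exact subset_iUnion (fun n : ℕ ↦ Metric.closedBall y (r - 1 / (n + 1))) n
  have h1 : ∀ᵐ x ∂volume.restrict (Metric.ball y r), u x τ ∈ Icc 0 μ := by
    rw [ball_eq_iUnion_closedBall, ae_restrict_iUnion_iff]
    exact fun n ↦ h.slice_mem_Icc hm hst hBs hμ (isCompact_closedBall _ _) (hsub n)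
      ((hsub n).trans hBΩ) hτ
  have h2 : AEStronglyMeasurable (fun x ↦ u x τ) (volume.restrict (Metric.ball y r)) := by
    rw [ball_eq_iUnion_closedBall, aestronglyMeasurable_iUnion_iff]
    exact fun n ↦ (h.memLp_slice _ (isCompact_closedBall _ _) ((hsub n).trans hBΩ) τ hτ.2).1
  have : IsFiniteMeasure (volume.restrict (Metric.ball y r)) :=
    ⟨by simpa using measure_ball_lt_top⟩
  refine ⟨h1, (integrable_const μ).mono' (aestronglyMeasurable_const.sub h2) ?_⟩
  filter_upwards [h1] with x hx
  rw [Real.norm_of_nonneg (by linarith [hx.2])]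
  linarith [hx.1]

/-- The weighted mass `∫ ζ^k W^β` is controlled by `∫ ζ^(k+2) W` and the measure of the ball. -/
theorem rpow_mul_integral_le {α β ν δ : ℝ} {k : ℕ} (hα : 0 < α) (hβ : 0 < β)
    (hαβ : α + β = 1) (hk : ((k + 2 : ℕ) : ℝ) * β ≤ k) (hk0 : k ≠ 0) (hν : 0 ≤ ν) (hδ : 0 < δ)
    {B : Set (Space N)} (hB : MeasurableSet B) (hBf : volume B ≠ ⊤) {ζ W : Space N → ℝ}
    (hζB : ∀ x ∉ B, ζ x = 0) (h0 : ∀ x, 0 ≤ ζ x) (h1 : ∀ x, ζ x ≤ 1) (hW : ∀ x, 0 ≤ W x)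
    (hi : Integrable (fun x ↦ ζ x ^ (k + 2) * W x)) :
    ν ^ α * ∫ x, ζ x ^ k * W x ^ β ≤
      δ * (∫ x, ζ x ^ (k + 2) * W x) + δ ^ (-(β / α)) * ν * volume.real B := by
  have hind : Integrable (B.indicator (1 : Space N → ℝ)) :=
    (integrable_indicator_iff hB).2 (integrableOn_const (hs := hBf))
  rw [← integral_const_mul, ← integral_const_mul]
  have e : δ ^ (-(β / α)) * ν * volume.real B =
      ∫ x, δ ^ (-(β / α)) * ν * B.indicator (1 : Space N → ℝ) x := by
    rw [integral_const_mul, integral_indicator_one hB]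
  rw [e, ← integral_add (hi.const_mul δ) (hind.const_mul _)]
  refine integral_mono_of_nonneg (ae_of_all _ fun x ↦ ?_)
    ((hi.const_mul δ).add (hind.const_mul _)) (ae_of_all _ fun x ↦ ?_)
  · exact mul_nonneg (Real.rpow_nonneg hν _) (mul_nonneg (pow_nonneg (h0 x) _)
      (Real.rpow_nonneg (hW x) _))
  · by_cases hx : x ∈ B
    -- Since `0 ≤ ζ ≤ 1` and `(k+2) β ≤ k`, the lower power `ζ^k` is dominated, so interpolation may
    -- be applied to the product `ζ^(k+2) W`.
    · have hle : ζ x ^ k ≤ (ζ x ^ (k + 2)) ^ β := by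
        rcases (h0 x).eq_or_lt with hz | hz
        · rw [← hz]; simp only [ne_eq, hk0, not_false_eq_true, zero_pow]; positivity
        · rw [← Real.rpow_natCast, ← Real.rpow_natCast, ← Real.rpow_mul (h0 x)]
          exact Real.rpow_le_rpow_of_exponent_ge hz (h1 x) hk
      have := rpow_mul_rpow_le hα hβ hαβ (mul_nonneg (pow_nonneg (h0 x) (k + 2)) (hW x)) hν hδ
      simp only [hx, indicator_of_mem, Pi.one_apply, mul_one]
      refine le_trans ?_ this
      rw [Real.mul_rpow (pow_nonneg (h0 x) _) (hW x)]
      have := Real.rpow_nonneg (hW x) β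
      gcongr
    · simp [hζB x hx, hx, hk0]

end

/-! ### The absorption argument. -/

/-- Interpolating the sublinear quantity `ν^α ∫ ζ^k W^β` against `∫ ζ^(k+2) W` bounds the
oscillation by half the supremum plus a multiple of `ν`. The factor `1/2` is what permits
absorption. -/
theorem exists_abs_weighted_integral_sub_le {p K₁ K₂ Λ : ℝ} (hp : 1 < p) (hp2 : p < 2)
    (hK₁ : 0 < K₁) (hK₂ : 0 < K₂) (hΛ : 0 ≤ Λ) :
    ∃ (n : ℕ) (C : ℝ), n ≠ 0 ∧ 0 < C ∧ ∀ (N : ℕ) (O : Set (Space N)) (t₁ t₂ μ : ℝ)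
      (U : Space N → ℝ → ℝ) (F V : Space N → ℝ → Space N),
      IsDivergenceSolution O t₁ t₂ μ p (p / (p - 1)) U F V →
      IsOpen O → volume O ≠ ⊤ → ∀ e : ℝ, 0 ≤ e →
      (∀ᵐ z ∂(volume : Measure (Space N)).prod (volume.restrict (Ioc t₁ t₂)), z.1 ∈ O →
        U z.1 z.2 ∈ Icc 0 μ ∧ ‖F z.1 z.2‖ ≤ K₂ * U z.1 z.2 ^ e * ‖V z.1 z.2‖ ^ (p - 1) ∧
        K₁ * U z.1 z.2 ^ e * ‖V z.1 z.2‖ ^ p ≤ inner ℝ (F z.1 z.2) (V z.1 z.2)) →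
      ∀ ζ : Space N → ℝ, ContDiff ℝ 1 ζ → HasCompactSupport ζ → tsupport ζ ⊆ O →
      (∀ x, 0 ≤ ζ x) → (∀ x, ζ x ≤ 1) → ∀ L ν D : ℝ, (∀ x, ‖gradient ζ x‖ ≤ L) → 0 < ν →
      L ^ p * μ ^ e * (t₂ - t₁) ≤ Λ * ν ^ (2 - p) →
      (∀ τ ∈ Icc t₁ t₂, ∫ x, ζ x ^ n * (μ - U x τ) ≤ D) →
      |(∫ x, ζ x ^ n * (μ - U x t₂)) - ∫ x, ζ x ^ n * (μ - U x t₁)| ≤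
        D / 2 + C * ν * volume.real O := by
  set α : ℝ := (2 - p) / p with hα
  set β : ℝ := 2 * (p - 1) / p with hβ
  have hp0 : 0 < p := by linarith
  have hα0 : 0 < α := div_pos (by linarith) hp0
  have hβ0 : 0 < β := div_pos (by linarith) hp0
  have hαβ : α + β = 1 := by rw [hα, hβ]; field_simp; ring
  -- As `α + β = 1`, this amounts to `(k+2) β ≤ k`.
  obtain ⟨k, hk⟩ := exists_nat_ge (2 * β / α)
  have hk0 : k ≠ 0 := by
    rintro rfl
    have : 0 < 2 * β / α := by positivity
    simp only [Nat.cast_zero] at hk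
    linarith
  have hkβ : ((k + 2 : ℕ) : ℝ) * β ≤ k := by
    rw [div_le_iff₀ hα0] at hk
    push_cast
    calc ((k : ℝ) + 2) * β = k * β + 2 * β := by ring
      _ ≤ k * β + k * α := by linarith
      _ = k := by rw [← mul_add, add_comm β, hαβ, mul_one]
  obtain ⟨C, hC, hmain⟩ := exists_abs_integral_sub_le hp hp2 hK₁ hK₂ hΛ hk0
  -- Chosen so that `C δ = 1/2`.
  set δ : ℝ := 1 / (2 * C) with hδ
  have hδ0 : 0 < δ := by positivity
  set E : ℝ := δ ^ (-(β / α)) with hE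
  have hE0 : 0 < E := Real.rpow_pos_of_pos hδ0 _
  refine ⟨k + 2, C * (δ + E), by omega, by positivity, ?_⟩
  intro N O t₁ t₂ μ U F V h hO hOf e he hflux ζ hζ hζs hζO h0 h1 L ν D hL hν hLν hD
  have hη : Continuous fun x ↦ ζ x ^ (k + 2) := hζ.continuous.pow _
  have hηO : tsupport (fun x ↦ ζ x ^ (k + 2)) ⊆ O :=
    (tsupport_pow_subset ζ (by omega)).trans hζO
  have hηs : HasCompactSupport fun x ↦ ζ x ^ (k + 2) :=
    hζs.mono fun x hx hz ↦ hx (by simp [hz])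
  have hηi : Integrable fun x ↦ ζ x ^ (k + 2) := hη.integrable_of_hasCompactSupport hηs
  have hζ0 : ∀ x ∉ O, ζ x = 0 := fun x hx ↦ image_eq_zero_of_notMem_tsupport fun hz ↦ hx (hζO hz)
  have hηle : ∫ x, ζ x ^ (k + 2) ≤ volume.real O := by
    rw [← integral_indicator_one hO.measurableSet]
    refine integral_mono hηi
      ((integrable_indicator_iff hO.measurableSet).2 (integrableOn_const (hs := hOf))) fun x ↦ ?_
    by_cases hx : x ∈ O
    · simpa [hx] using pow_le_one₀ (h0 x) (h1 x)
    · simp [hζ0 x hx, hx]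
  have hint : ∀ τ ∈ Icc t₁ t₂, ∀ c : ℝ → ℝ, Continuous c →
      Integrable fun x ↦ ζ x ^ (k + 2) * c (U x τ) := fun τ hτ c hc ↦
    integrable_mul_comp_of_mem_Icc (h.integrable_slice τ hτ).1 (h.bound τ hτ) hη hηs hηO hc
  have hdiff : ∀ τ ∈ Icc t₁ t₂, ∫ x, ζ x ^ (k + 2) * (μ - U x τ) =
      μ * (∫ x, ζ x ^ (k + 2)) - ∫ x, ζ x ^ (k + 2) * U x τ := fun τ hτ ↦ by
    rw [← integral_const_mul, ← integral_sub (hηi.const_mul μ) (hint τ hτ (fun v ↦ v) continuous_id)]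
    exact integral_congr_ae (ae_of_all _ fun x ↦ by ring)
  rw [hdiff t₂ (right_mem_Icc.2 h.le), hdiff t₁ (left_mem_Icc.2 h.le), sub_sub_sub_cancel_left,
    abs_sub_comm]
  refine (hmain N O t₁ t₂ μ U F V h hO e he hflux ζ hζ hζs hζO h0 h1 L ν
    (ν ^ (-α) * (δ * D + (δ + E) * ν * volume.real O)) hL hν hLν fun τ hτ ↦ ?_).trans (le_of_eq ?_)
  · have hW : ∀ x, 0 ≤ max (μ + ν - U x τ) (ν / 2) := fun x ↦
      le_trans (by positivity) (le_max_right _ _)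
    have h3 := rpow_mul_integral_le hα0 hβ0 hαβ hkβ hk0 hν.le hδ0 hO.measurableSet hOf hζ0 h0 h1 hW
      (hint τ hτ (fun v ↦ max (μ + ν - v) (ν / 2)) (by fun_prop))
    have h4 : ∫ x, ζ x ^ (k + 2) * max (μ + ν - U x τ) (ν / 2) =
        (∫ x, ζ x ^ (k + 2) * (μ - U x τ)) + ν * ∫ x, ζ x ^ (k + 2) := by
      rw [← integral_const_mul, ← integral_add (hint τ hτ (fun v ↦ μ - v) (by fun_prop))
        (hηi.const_mul ν)]
      refine integral_congr_ae ?_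
      filter_upwards [h.bound τ hτ] with x hx
      by_cases hxO : x ∈ O
      · rw [max_eq_left (by linarith [(hx hxO).2])]; ring
      · simp [hζ0 x hxO]
    have h5 := hD τ hτ
    rw [Real.rpow_neg hν.le, ← div_eq_inv_mul, le_div_iff₀' (Real.rpow_pos_of_pos hν _)]
    refine h3.trans ?_
    rw [h4]
    calc δ * ((∫ x, ζ x ^ (k + 2) * (μ - U x τ)) + ν * ∫ x, ζ x ^ (k + 2))
          + E * ν * volume.real O
        ≤ δ * (D + ν * volume.real O) + E * ν * volume.real O := by gcongr
      _ = δ * D + (δ + E) * ν * volume.real O := by ring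
  · have h6 : ν ^ α * ν ^ (-α) = 1 := by rw [← Real.rpow_add hν, add_neg_cancel, Real.rpow_zero]
    have h7 : C * δ = 1 / 2 := by rw [hδ]; field_simp
    calc C * ν ^ α * (ν ^ (-α) * (δ * D + (δ + E) * ν * volume.real O))
        = (ν ^ α * ν ^ (-α)) * (C * δ * D + C * (δ + E) * ν * volume.real O) := by ring
      _ = D / 2 + C * (δ + E) * ν * volume.real O := by rw [h6, h7]; ring

/-- The Harnack type inequality with an arbitrary `ν` at the intrinsic scale. -/
theorem exists_weighted_integral_le (N : ℕ) {m p K₁ K₂ : ℝ} (hm : 1 < m) (hp : 1 < p) (hp2 : p < 2)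
    (hK₁ : 0 < K₁) (hK₂ : 0 < K₂) :
    ∃ C : ℝ, 0 < C ∧ ∀ (Ω : Set (Space N)) (T : ℝ) (A : Space N → ℝ → ℝ → Space N → Space N)
      (u : Space N → ℝ → ℝ), IsCaratheodory Ω T A → StructureConditions Ω T m p K₁ K₂ A →
      IsWeakSolution Ω T m p A u → ∀ (y : Space N) (r s t μ ν : ℝ), 0 < r → s < t →
      Metric.ball y (2 * r) ×ˢ Ioo s t ⊆ spaceTime Ω T →
      (∀ᵐ z ∂(volume.restrict (Metric.ball y (2 * r) ×ˢ Ioo s t)), u z.1 z.2 ≤ μ) → 0 < ν →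
      μ ^ ((m - 1) * (p - 1)) * ((t - s) / r ^ p) ≤ ν ^ (2 - p) →
      ∀ τ₁ ∈ Icc s t ∩ Ioo 0 T, ∀ τ₂ ∈ Icc s t ∩ Ioo 0 T,
        ∫ x in Metric.ball y r, (μ - u x τ₁) ≤
          2 * (∫ x in Metric.ball y (2 * r), (μ - u x τ₂)) +
            C * ν * volume.real (Metric.ball y (2 * r)) := by
  obtain ⟨c, hc, hcut⟩ := exists_cutoff N
  obtain ⟨n, C, hn, hC, hmain⟩ := exists_abs_weighted_integral_sub_le hp hp2 hK₁ hK₂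
    (Real.rpow_nonneg hc.le p)
  refine ⟨2 * C, by positivity, ?_⟩
  intro Ω T A u hA hS hu y r s t μ ν hr hst hsub hμ hν hscale τ₁ hτ₁ τ₂ hτ₂
  obtain ⟨V₀, hreg, -⟩ := id hu
  obtain ⟨ζ, hζ, hζsupp, h0, h1, hone, hgrad⟩ := hcut y r hr
  -- Any radius strictly between `3r/2`, which contains the support of `ζ`, and `2r` would do.
  set R : ℝ := 7 / 4 * r with hR
  set B := Metric.ball y (2 * r) with hB
  set I := Icc s t ∩ Ioo 0 T with hI
  have hζO : tsupport ζ ⊆ Metric.ball y R :=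
    hζsupp.trans (Metric.closedBall_subset_ball (by rw [hR]; linarith))
  have hRB : Metric.ball y R ⊆ B := Metric.ball_subset_ball (by rw [hR]; linarith)
  have hrB : Metric.ball y r ⊆ B := Metric.ball_subset_ball (by linarith)
  have hζs : HasCompactSupport ζ :=
    (isCompact_closedBall y (3 / 2 * r)).of_isClosed_subset (isClosed_tsupport ζ) hζsupp
  have hζ0 : ∀ x ∉ Metric.ball y R, ζ x = 0 := fun x hx ↦
    image_eq_zero_of_notMem_tsupport fun hz ↦ hx (hζO hz)
  have hBm : MeasurableSet B := Metric.isOpen_ball.measurableSet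
  have hslice : ∀ τ ∈ I, (∀ᵐ x ∂volume.restrict B, u x τ ∈ Icc 0 μ) ∧
      IntegrableOn (fun x ↦ μ - u x τ) B := fun τ hτ ↦ hreg.ball_mem_Icc hm.le hst hsub hμ hτ
  set f : ℝ → ℝ := fun τ ↦ ∫ x in B, ζ x ^ n * (μ - u x τ) with hf
  have hfi : ∀ τ ∈ I, IntegrableOn (fun x ↦ ζ x ^ n * (μ - u x τ)) B := fun τ hτ ↦
    (hslice τ hτ).2.bdd_mul (c := 1) (hζ.continuous.pow n).aestronglyMeasurable (ae_of_all _ fun x ↦ by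
      rw [Real.norm_of_nonneg (pow_nonneg (h0 x) _)]; exact pow_le_one₀ (h0 x) (h1 x))
  have hfle : ∀ τ ∈ I, f τ ≤ ∫ x in B, (μ - u x τ) := fun τ hτ ↦ by
    refine integral_mono_ae (hfi τ hτ) (hslice τ hτ).2 ?_
    filter_upwards [(hslice τ hτ).1] with x hx
    exact mul_le_of_le_one_left (by linarith [hx.2]) (pow_le_one₀ (h0 x) (h1 x))
  have hlef : ∀ τ ∈ I, ∫ x in Metric.ball y r, (μ - u x τ) ≤ f τ := fun τ hτ ↦ by
    calc ∫ x in Metric.ball y r, (μ - u x τ)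
        = ∫ x in Metric.ball y r, ζ x ^ n * (μ - u x τ) :=
          setIntegral_congr_fun Metric.isOpen_ball.measurableSet fun x hx ↦ by simp [hone x hx]
      _ ≤ f τ := setIntegral_mono_set (hfi τ hτ) (by
          filter_upwards [(hslice τ hτ).1] with x hx
          exact mul_nonneg (pow_nonneg (h0 x) _) (by linarith [hx.2])) hrB.eventuallyLE
  -- From `u ≥ 0` the supremum `D` is finite; without this `D / 2` could not be absorbed.
  have hbdd : BddAbove (f '' I) := by
    refine ⟨μ * volume.real B, ?_⟩
    rintro _ ⟨τ, hτ, rfl⟩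
    refine (hfle τ hτ).trans ?_
    calc ∫ x in B, (μ - u x τ) ≤ ∫ _ in B, μ := by
          refine integral_mono_ae (hslice τ hτ).2
            (integrableOn_const (hs := measure_ball_lt_top.ne)) ?_
          filter_upwards [(hslice τ hτ).1] with x hx
          linarith [hx.1]
      _ = μ * volume.real B := by rw [setIntegral_const, smul_eq_mul, mul_comm]
  set D : ℝ := sSup (f '' I) with hD
  have hfD : ∀ τ ∈ I, f τ ≤ D := fun τ hτ ↦ le_csSup hbdd (mem_image_of_mem f hτ)
  have hμ0 : 0 ≤ μ := by
    have : NeBot (ae (volume.restrict B)) :=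
      ae_restrict_neBot.2 (Metric.measure_ball_pos volume y (by positivity)).ne'
    obtain ⟨x, hx⟩ := (hslice τ₁ hτ₁).1.exists
    exact hx.1.trans hx.2
  have hord : ∀ σ₁ ∈ I, ∀ σ₂ ∈ I, σ₁ ≤ σ₂ → |f σ₂ - f σ₁| ≤ D / 2 + C * ν * volume.real B := by
    intro σ₁ hσ₁ σ₂ hσ₂ h12
    obtain ⟨F, V, hsol, hflux⟩ := hu.exists_isDivergenceSolution hm hp hA hS hK₂ hst hsub hμ
      (R := R) (by rw [hR]; positivity) (by rw [hR]; linarith) hσ₁ hσ₂ h12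
    have hIcc : ∀ τ ∈ Icc σ₁ σ₂, τ ∈ I := fun τ hτ ↦
      ⟨⟨hσ₁.1.1.trans hτ.1, hτ.2.trans hσ₂.1.2⟩, ⟨hσ₁.2.1.trans_le hτ.1, hτ.2.trans_lt hσ₂.2.2⟩⟩
    have hfeq : ∀ τ, ∫ x, ζ x ^ n * (μ - (Metric.closedBall y R).indicator (fun x ↦ u x τ) x) =
        f τ := fun τ ↦ by
      rw [hf]
      simp only
      rw [← integral_indicator hBm]
      refine integral_congr_ae (ae_of_all _ fun x ↦ ?_)
      by_cases hx : x ∈ Metric.ball y R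
      · simp [indicator_of_mem (hRB hx), indicator_of_mem (Metric.ball_subset_closedBall hx)]
      · by_cases hxB : x ∈ B <;> simp [hζ0 x hx, hn, hxB]
    have hb : volume.real (Metric.ball y R) ≤ volume.real B :=
      measureReal_mono hRB measure_ball_lt_top.ne
    have h2 := hmain N (Metric.ball y R) σ₁ σ₂ μ _ F V hsol Metric.isOpen_ball
      measure_ball_lt_top.ne ((m - 1) * (p - 1))
      (mul_nonneg (by linarith) (by linarith)) (by
        filter_upwards [hflux] with z hz hzR
        have hz' := Metric.ball_subset_closedBall hzR
        simp only [indicator_of_mem hz']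
        exact hz hz')
      ζ hζ hζs hζO h0 h1 (c / r) ν D hgrad hν (by
        have hσ : σ₂ - σ₁ ≤ t - s := by linarith [hσ₁.1.1, hσ₂.1.2]
        have hμe := Real.rpow_nonneg hμ0 ((m - 1) * (p - 1))
        rw [Real.div_rpow hc.le hr.le]
        calc c ^ p / r ^ p * μ ^ ((m - 1) * (p - 1)) * (σ₂ - σ₁)
            ≤ c ^ p / r ^ p * μ ^ ((m - 1) * (p - 1)) * (t - s) := by gcongr
          _ = c ^ p * (μ ^ ((m - 1) * (p - 1)) * ((t - s) / r ^ p)) := by ring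
          _ ≤ c ^ p * ν ^ (2 - p) := by gcongr)
      (fun τ hτ ↦ by rw [hfeq]; exact hfD τ (hIcc τ hτ))
    rw [hfeq, hfeq] at h2
    refine h2.trans ?_
    gcongr
  -- The oscillation bound is two-sided, so the order of `σ` and `τ₂` is immaterial.
  have hosc : ∀ σ ∈ I, f σ ≤ f τ₂ + (D / 2 + C * ν * volume.real B) := by
    intro σ hσ
    rcases le_total σ τ₂ with h | h
    · linarith [abs_le.1 (hord σ hσ τ₂ hτ₂ h)]
    · linarith [abs_le.1 (hord τ₂ hτ₂ σ hσ h)]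
  have hDle : D ≤ f τ₂ + (D / 2 + C * ν * volume.real B) :=
    csSup_le ((nonempty_of_mem hτ₁).image f) (by rintro _ ⟨σ, hσ, rfl⟩; exact hosc σ hσ)
  linarith [hlef τ₁ hτ₁, hfD τ₁ hτ₁, hfle τ₂ hτ₂]

end DoublyNonlinear

/-! ### The inequality for averages. -/

theorem theorem3p2 (N : ℕ) (hN : 1 ≤ N) (m p K₁ K₂ : ℝ) (hm : 0 < m) (hp : 1 < p)
    (hK₁ : 0 < K₁) (hK₂ : 0 < K₂) (hlam : 1 < m * (p - 1)) (hp2 : p < 2) :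
    ∃ γ : ℝ, 0 < γ ∧
      ∀ (Ω : Set (DoublyNonlinear.Space N)) (T : ℝ)
        (A : DoublyNonlinear.Space N → ℝ → ℝ → DoublyNonlinear.Space N → DoublyNonlinear.Space N)
        (u : DoublyNonlinear.Space N → ℝ → ℝ),
        IsOpen Ω → IsConnected Ω → 0 < T →
        DoublyNonlinear.IsCaratheodory Ω T A →
        DoublyNonlinear.StructureConditions Ω T m p K₁ K₂ A →
        DoublyNonlinear.IsWeakSolution Ω T m p A u →
        ∀ (y : DoublyNonlinear.Space N) (r s t μ : ℝ), 0 < r → s < t →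
          Metric.ball y (2 * r) ×ˢ Ioo s t ⊆ DoublyNonlinear.spaceTime Ω T →
          (∀ᵐ z ∂(volume.restrict (Metric.ball y (2 * r) ×ˢ Ioo s t)), u z.1 z.2 ≤ μ) →
          (∀ τ ∈ Icc s t ∩ Ioo 0 T,
            IntegrableOn (fun x => μ - u x τ) (Metric.ball y (2 * r))) ∧
          ∀ τ₁ ∈ Icc s t ∩ Ioo 0 T, ∀ τ₂ ∈ Icc s t ∩ Ioo 0 T,
            (⨍ x in Metric.ball y r, (μ - u x τ₁)) ≤
              γ * (⨍ x in Metric.ball y (2 * r), (μ - u x τ₂)) +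
              γ * μ ^ ((m - 1) * (p - 1) / (2 - p)) * ((t - s) / r ^ p) ^ (1 / (2 - p)) := by
  have hm1 : 1 < m := by nlinarith
  obtain ⟨C, hC, hmain⟩ := DoublyNonlinear.exists_weighted_integral_le N hm1 hp hp2 hK₁ hK₂
  -- The factor `2^N` is the ratio of the volumes of the two balls; `2 + C` dominates both the
  -- coefficient `2` and the coefficient `C`.
  refine ⟨2 ^ N * (2 + C), by positivity, ?_⟩
  intro Ω T A u _ _ _ hA hS hu y r s t μ hr hst hsub hμ
  obtain ⟨V₀, hreg, -⟩ := id hu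
  have hslice : ∀ τ ∈ Icc s t ∩ Ioo 0 T, _ := fun τ hτ ↦ hreg.ball_mem_Icc hm1.le hst hsub hμ hτ
  refine ⟨fun τ hτ ↦ (hslice τ hτ).2, fun τ₁ hτ₁ τ₂ hτ₂ ↦ ?_⟩
  have h2p : 0 < 2 - p := by linarith
  have hpos : ∀ ρ : ℝ, 0 < ρ → 0 < volume.real (Metric.ball y ρ) := fun ρ hρ ↦
    ENNReal.toReal_pos (Metric.measure_ball_pos volume y hρ).ne' measure_ball_lt_top.ne
  have hμ0 : 0 ≤ μ := by
    have : NeBot (ae (volume.restrict (Metric.ball y (2 * r)))) :=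
      ae_restrict_neBot.2 (Metric.measure_ball_pos volume y (by positivity)).ne'
    obtain ⟨x, hx⟩ := (hslice τ₁ hτ₁).1.exists
    exact hx.1.trans hx.2
  have hJ : 0 ≤ ∫ x in Metric.ball y (2 * r), (μ - u x τ₂) := by
    refine integral_nonneg_of_ae ?_
    filter_upwards [(hslice τ₂ hτ₂).1] with x hx
    exact sub_nonneg.2 hx.2
  have hvol : volume.real (Metric.ball y (2 * r)) = 2 ^ N * volume.real (Metric.ball y r) := by
    rw [measureReal_def, measureReal_def, Measure.addHaar_ball_mul_of_pos volume y two_pos r,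
      ENNReal.toReal_mul, finrank_euclideanSpace_fin, ENNReal.toReal_ofReal (by positivity),
      Measure.addHaar_ball_center volume y r]
  have hθ : 0 ≤ (t - s) / r ^ p := div_nonneg (by linarith) (Real.rpow_nonneg hr.le p)
  set ν₀ : ℝ := μ ^ ((m - 1) * (p - 1) / (2 - p)) * ((t - s) / r ^ p) ^ (1 / (2 - p)) with hν₀
  have hν₀0 : 0 ≤ ν₀ := mul_nonneg (Real.rpow_nonneg hμ0 _) (Real.rpow_nonneg hθ _)
  have hν₀e : ν₀ ^ (2 - p) = μ ^ ((m - 1) * (p - 1)) * ((t - s) / r ^ p) := by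
    rw [hν₀, Real.mul_rpow (Real.rpow_nonneg hμ0 _) (Real.rpow_nonneg hθ _), ← Real.rpow_mul hμ0,
      ← Real.rpow_mul hθ, div_mul_cancel₀ _ h2p.ne', div_mul_cancel₀ _ h2p.ne', Real.rpow_one]
  have hle : ∫ x in Metric.ball y r, (μ - u x τ₁) ≤
      2 * (∫ x in Metric.ball y (2 * r), (μ - u x τ₂)) +
        C * ν₀ * volume.real (Metric.ball y (2 * r)) := by
    have hb := hpos (2 * r) (by positivity)
    -- The critical value `ν₀` vanishes when `μ = 0`, while the estimate needs `ν > 0`; so it is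
    -- applied with `ν₀ + κ`, the extra contribution of `κ` being exactly `ε`.
    refine le_of_forall_pos_le_add fun ε hε ↦ ?_
    set κ : ℝ := ε / (C * volume.real (Metric.ball y (2 * r))) with hκ
    have hκ0 : 0 < κ := by positivity
    have := hmain Ω T A u hA hS hu y r s t μ (ν₀ + κ) hr hst hsub hμ (by positivity)
      (hν₀e ▸ Real.rpow_le_rpow hν₀0 (by linarith) h2p.le) τ₁ hτ₁ τ₂ hτ₂
    refine this.trans (le_of_eq ?_)
    rw [hκ]
    field_simp
    ring
  have hb := hpos r hr
  rw [setAverage_eq, setAverage_eq, smul_eq_mul, smul_eq_mul, hvol, mul_assoc _ (μ ^ _), ← hν₀]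
  rw [hvol] at hle
  set J := ∫ x in Metric.ball y (2 * r), (μ - u x τ₂)
  set b := volume.real (Metric.ball y r)
  rw [inv_mul_le_iff₀ hb]
  refine hle.trans ?_
  have e : b * (2 ^ N * (2 + C) * ((2 ^ N * b)⁻¹ * J) + 2 ^ N * (2 + C) * ν₀) =
      (2 + C) * J + (2 + C) * ν₀ * (2 ^ N * b) := by
    field_simp
  rw [e]
  gcongr <;> linarith
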